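/- For a finite simple graph $G$, a set $S\subseteq V(G)$ is an independent cutset if its vertices are pairwise non-adjacent and $G-S$ is disconnected (has at least two components). Independent Cutset is the problem of deciding, for a given connected graph $G$, whether $G$ has an independent cutset, and of returning one if it exists. An odd cycle transversal of $G$ is a set $X\subseteq V(G)$ such that $G-X$ is bipartite; a triangle-hitting set of $G$ is a set $X\subseteq V(G)$ such that $G-X$ is triangle-free. Running times are deterministic, measured on a random access machine with unit-cost addition and subtraction that is given only the adjacency matrix of $G$, and $\mathcal{O}^*(3^k)$ means at most $3^k\cdot q(n)$ steps for some fixed polynomial $q$, where $n=|V(G)|$. Then: 1. Independent Cutset can be solved in $\mathcal{O}^*(3^k)$ time, where $k$ is the odd cycle transversal number of $G$, that is, the minimum size of an odd cycle transversal of $G$. 2. Independent Cutset can be solved in $\mathcal{O}^*(3^k)$ time, where $k$ is the minimum size of a triangle-hitting set of $G$. -/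

import Mathlib

namespace IndCut

/-! ## Graph notions -/

section Graphs

variable {V : Type*}

/-- `S` is a cutset of `G`: the graph `G - S` is disconnected, that is, it has two vertices that no
path of `G - S` joins. (The graph without vertices is not disconnected.) -/
def IsCutset (G : SimpleGraph V) (S : Set V) : Prop :=
  ¬ (G.induce Sᶜ).Preconnected

/-- `S` is both an independent set and a cutset of `G`. -/
def IsIndependentCutset (G : SimpleGraph V) (S : Set V) : Prop :=
  G.IsIndepSet S ∧ IsCutset G S

/-- `G - X` is bipartite. -/
def IsOddCycleTransversal (G : SimpleGraph V) (X : Set V) : Prop :=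
  (G.induce Xᶜ).IsBipartite

/-- `G - X` is triangle-free. -/
def IsTriangleHittingSet (G : SimpleGraph V) (X : Set V) : Prop :=
  (G.induce Xᶜ).CliqueFree 3

/-- The minimum size of an odd cycle transversal of `G`. -/
noncomputable def oddCycleTransversalNumber [Fintype V] (G : SimpleGraph V) : ℕ :=
  sInf {k : ℕ | ∃ X : Finset V, IsOddCycleTransversal G (X : Set V) ∧ X.card = k}

/-- The minimum size of a triangle-hitting set of `G`. -/
noncomputable def triangleHittingNumber [Fintype V] (G : SimpleGraph V) : ℕ :=
  sInf {k : ℕ | ∃ X : Finset V, IsTriangleHittingSet G (X : Set V) ∧ X.card = k}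

/-- The minimum in `oddCycleTransversalNumber` is attained. -/
theorem exists_card_eq_oddCycleTransversalNumber [Fintype V] (G : SimpleGraph V) :
    ∃ X : Finset V, IsOddCycleTransversal G (X : Set V) ∧
      X.card = oddCycleTransversalNumber G := by
  refine Nat.sInf_mem (s := {k : ℕ | ∃ X : Finset V,
    IsOddCycleTransversal G (X : Set V) ∧ X.card = k}) ⟨_, Finset.univ, ?_, rfl⟩
  refine ⟨SimpleGraph.Coloring.mk (fun _ => 0) ?_⟩
  intro a
  exact absurd (Finset.mem_coe.2 (Finset.mem_univ a.1)) a.2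

/-- The minimum in `triangleHittingNumber` is attained. -/
theorem exists_card_eq_triangleHittingNumber [Fintype V] (G : SimpleGraph V) :
    ∃ X : Finset V, IsTriangleHittingSet G (X : Set V) ∧
      X.card = triangleHittingNumber G := by
  refine Nat.sInf_mem (s := {k : ℕ | ∃ X : Finset V,
    IsTriangleHittingSet G (X : Set V) ∧ X.card = k}) ⟨_, Finset.univ, ?_, rfl⟩
  intro t ht
  obtain ⟨a, -⟩ := Finset.card_pos.1 (ht.card_eq ▸ (by decide : 0 < 3))
  exact absurd (Finset.mem_coe.2 (Finset.mem_univ a.1)) a.2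

end Graphs

/-! ## The machine model

Structured programs for a random access machine: natural-number registers, finitely many arrays
(those that the program names) with indirect addressing, and addition and truncated subtraction as
the only arithmetic. Every operation takes one step. There is no multiplication, so this machine
and the Turing machine simulate each other with polynomial overhead. -/

/-- A memory configuration: `reg x` is the content of register `x`, and `arr a i` is the content of
cell `i` of array `a`. -/
structure Store where
  reg : ℕ → ℕ
  arr : ℕ → ℕ → ℕ

/-- Set register `x` to `v`. -/
def Store.setReg (s : Store) (x v : ℕ) : Store :=
  { s with reg := Function.update s.reg x v }

/-- Set cell `i` of array `a` to `v`. -/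
def Store.setArr (s : Store) (a i v : ℕ) : Store :=
  { s with arr := Function.update s.arr a (Function.update (s.arr a) i v) }

/-- Arithmetic expressions: constants, registers, array cells, sums, truncated differences. -/
inductive Expr : Type
  | lit (c : ℕ)
  | reg (x : ℕ)
  | arr (a : ℕ) (i : Expr)
  | add (e₁ e₂ : Expr)
  | sub (e₁ e₂ : Expr)

/-- The value of an expression. -/
def Expr.eval (s : Store) : Expr → ℕ
  | .lit c => c
  | .reg x => s.reg x
  | .arr a i => s.arr a (i.eval s)
  | .add e₁ e₂ => e₁.eval s + e₂.eval s
  | .sub e₁ e₂ => e₁.eval s - e₂.eval s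

/-- The number of steps needed to evaluate an expression, one for each operation in it. -/
def Expr.cost : Expr → ℕ
  | .lit _ => 1
  | .reg _ => 1
  | .arr _ i => i.cost + 1
  | .add e₁ e₂ => e₁.cost + e₂.cost + 1
  | .sub e₁ e₂ => e₁.cost + e₂.cost + 1

/-- Programs. A test `e` succeeds if the value of `e` is not `0`. -/
inductive Program : Type
  | skip
  | assign (x : ℕ) (e : Expr)
  | write (a : ℕ) (i e : Expr)
  | seq (p₁ p₂ : Program)
  | branch (e : Expr) (p₁ p₂ : Program)
  | loop (e : Expr) (p : Program)

/-- `Exec p s t s'`: started on the memory `s`, the program `p` halts after exactly `t` steps with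
the memory `s'`. -/
inductive Exec : Program → Store → ℕ → Store → Prop
  | skip (s : Store) : Exec .skip s 1 s
  | assign (x : ℕ) (e : Expr) (s : Store) :
      Exec (.assign x e) s (e.cost + 1) (s.setReg x (e.eval s))
  | write (a : ℕ) (i e : Expr) (s : Store) :
      Exec (.write a i e) s (i.cost + e.cost + 1) (s.setArr a (i.eval s) (e.eval s))
  | seq {p₁ p₂ : Program} {s s₁ s₂ : Store} {t₁ t₂ : ℕ} :
      Exec p₁ s t₁ s₁ → Exec p₂ s₁ t₂ s₂ → Exec (.seq p₁ p₂) s (t₁ + t₂) s₂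
  | branch_true {e : Expr} {p₁ p₂ : Program} {s s' : Store} {t : ℕ} :
      e.eval s ≠ 0 → Exec p₁ s t s' → Exec (.branch e p₁ p₂) s (e.cost + 1 + t) s'
  | branch_false {e : Expr} {p₁ p₂ : Program} {s s' : Store} {t : ℕ} :
      e.eval s = 0 → Exec p₂ s t s' → Exec (.branch e p₁ p₂) s (e.cost + 1 + t) s'
  | loop_true {e : Expr} {p : Program} {s s₁ s₂ : Store} {t₁ t₂ : ℕ} :
      e.eval s ≠ 0 → Exec p s t₁ s₁ → Exec (.loop e p) s₁ t₂ s₂ →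
        Exec (.loop e p) s (e.cost + 1 + t₁ + t₂) s₂
  | loop_false {e : Expr} {p : Program} {s : Store} :
      e.eval s = 0 → Exec (.loop e p) s (e.cost + 1) s

/-- Programs are deterministic: the number of steps and the final memory are determined by the
initial memory. -/
theorem Exec.deterministic {p : Program} {s s₁ s₂ : Store} {t₁ t₂ : ℕ}
    (h₁ : Exec p s t₁ s₁) (h₂ : Exec p s t₂ s₂) : t₁ = t₂ ∧ s₁ = s₂ := by
  induction h₁ generalizing t₂ s₂ with
  | skip s => cases h₂; exact ⟨rfl, rfl⟩
  | assign x e s => cases h₂; exact ⟨rfl, rfl⟩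
  | write a i e s => cases h₂; exact ⟨rfl, rfl⟩
  | seq _ _ ih₁ ih₂ =>
    cases h₂ with
    | seq k₁ k₂ =>
      obtain ⟨rfl, rfl⟩ := ih₁ k₁
      obtain ⟨rfl, rfl⟩ := ih₂ k₂
      exact ⟨rfl, rfl⟩
  | branch_true h _ ih =>
    cases h₂ with
    | branch_true _ k => obtain ⟨rfl, rfl⟩ := ih k; exact ⟨rfl, rfl⟩
    | branch_false h' _ => exact absurd h' h
  | branch_false h _ ih =>
    cases h₂ with
    | branch_true h' _ => exact absurd h h'
    | branch_false _ k => obtain ⟨rfl, rfl⟩ := ih k; exact ⟨rfl, rfl⟩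
  | loop_true h _ _ ih₁ ih₂ =>
    cases h₂ with
    | loop_true _ k₁ k₂ =>
      obtain ⟨rfl, rfl⟩ := ih₁ k₁
      obtain ⟨rfl, rfl⟩ := ih₂ k₂
      exact ⟨rfl, rfl⟩
    | loop_false h' => exact absurd h' h
  | loop_false h =>
    cases h₂ with
    | loop_true h' _ _ => exact absurd h h'
    | loop_false _ => exact ⟨rfl, rfl⟩

/-! ## The computational problem -/

open Classical in
/-- The input for a graph `G` with vertices `0, …, n - 1`: register `0` holds `n`, and cell
`i * n + j` of array `0` holds `1` for every adjacent pair `i`, `j` of vertices. All other registers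
and cells hold `0`. -/
noncomputable def inputStore {n : ℕ} (G : SimpleGraph (Fin n)) : Store where
  reg x := if x = 0 then n else 0
  arr a m := if a = 0 ∧ ∃ i j : Fin n, m = i.val * n + j.val ∧ G.Adj i j then 1 else 0

/-- The set of vertices that array `1` marks with the entry `1`. -/
def outputSet (n : ℕ) (s : Store) : Set (Fin n) :=
  {v | s.arr 1 v.val = 1}

/-- On input `G`, the program `p` halts within `T` steps and solves the independent cutset problem:
either it answers `1` in register `0` and array `1` marks the vertices of an independent cutset
of `G`, or it answers `0` in register `0` and `G` has no independent cutset. -/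
def SolvesWithin (p : Program) {n : ℕ} (G : SimpleGraph (Fin n)) (T : ℕ) : Prop :=
  ∃ (t : ℕ) (s : Store), Exec p (inputStore G) t s ∧ t ≤ T ∧
    ((s.reg 0 = 1 ∧ IsIndependentCutset G (outputSet n s)) ∨
      (s.reg 0 = 0 ∧ ¬ ∃ S : Set (Fin n), IsIndependentCutset G S))

end IndCut

/-!
# Independent cutsets in time `O*(3 ^ k)`

A bipartite graph is triangle-free, so the triangle-hitting number `k` is at most the odd cycle
transversal number, and one program with the bound `3 ^ k * q(n)` for the former serves both claims.

*Small dominating sets.* A vertex `v` in no triangle has an independent neighbourhood `N(v)`, which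
is an independent cutset unless `v` is adjacent to all other vertices. The program tries these
neighbourhoods first (`neighborhoodsP`). If none is a cutset, but there is an independent cutset,
then every vertex lies in a triangle (`exists_tri_of_no_neighborhood`), so every set `X` that hits
all triangles dominates the remaining vertices.

*A minimum hitting set.* One pass over all triples, in which a ternary digit decides which vertex of
each triangle not yet hit is removed, gives a hitting set (`hitList`), and some sequence of `k`
digits leads to one with at most `k` vertices (`exists_digits_hitList`). The program runs through
`m = 0, 1, 2, …`, uses the ternary digits of `m`, and stops when `m` reaches `3 ^ l`, where `l` is
the size of the best hitting set so far. This happens at `l = k`, after at most `3 ^ k` iterations,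
so `k` need not be known.

*Extending a guess.* An independent cutset is a labelling of the vertices with `0` (the cutset), `1`
and `2` (the two sides) in which the labels of adjacent vertices never add up to `0` modulo `3`, and
in which `1` and `2` occur. The program runs through all `3 ^ k` labellings of `X` and all pairs of
vertices with labels `1` and `2`. As `X` dominates, arc consistency leaves at most two labels at
each vertex. Such an instance is solved greedily, as 2-SAT is by unit propagation: a choice whose
propagation empties no domain can be kept (`exists_proper_within`).

*The machine.* Apart from the two searches over `m`, the program consists of loops over the vertices
and tests with quantifiers over the vertices. `BProg` is a language of such programs, with a total
semantics `BProg.run`, a polynomial time bound `BProg.time`, and a translation `BProg.code` into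
machine programs whose correctness and running time are `BProg.runs_code`. All properties of the
algorithm are proved for `BProg.run`.

Registers: `0` holds the number of vertices, `1` the answer, `2` the number `m`, `3` the size of the
best hitting set, `5` the size of the current one; `4`, `6`, `7`, `8` are auxiliary; loop indices
start at `10`. Arrays: `0` adjacency matrix, `1` output, `2` row offsets, `3` powers of `3`, `4`
digits, `5` and `6` the current hitting set as marks and as a list, `7` the best hitting set, `10`
to `12` and `13` to `15` allowed labels.
-/

namespace IndCut

/-! ### Running programs within a time bound -/

@[simp] theorem Store.setReg_reg (s : Store) (x v y : ℕ) :
    (s.setReg x v).reg y = if y = x then v else s.reg y := by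
  simp [Store.setReg, Function.update_apply]

@[simp] theorem Store.setReg_arr (s : Store) (x v : ℕ) : (s.setReg x v).arr = s.arr := rfl

@[simp] theorem Store.setArr_reg (s : Store) (a i v : ℕ) : (s.setArr a i v).reg = s.reg := rfl

@[simp] theorem Store.setArr_arr (s : Store) (a i v b j : ℕ) :
    (s.setArr a i v).arr b j = if b = a ∧ j = i then v else s.arr b j := by
  by_cases hb : b = a
  · subst hb
    simp [Store.setArr, Function.update_apply]
  · simp [Store.setArr, hb]

/-- Started on `s`, the program `p` halts within `T` steps with a memory that satisfies `Q`. -/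
def Runs (p : Program) (s : Store) (T : ℕ) (Q : Store → Prop) : Prop :=
  ∃ (t : ℕ) (s' : Store), Exec p s t s' ∧ t ≤ T ∧ Q s'

theorem Runs.mono {p : Program} {s : Store} {T T' : ℕ} {Q Q' : Store → Prop}
    (h : Runs p s T Q) (hT : T ≤ T') (hQ : ∀ s', Q s' → Q' s') : Runs p s T' Q' := by
  obtain ⟨t, s', he, ht, hs⟩ := h
  exact ⟨t, s', he, ht.trans hT, hQ _ hs⟩

theorem Runs.seq {p q : Program} {s : Store} {T₁ T₂ : ℕ} {Q R : Store → Prop}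
    (h₁ : Runs p s T₁ Q) (h₂ : ∀ s', Q s' → Runs q s' T₂ R) :
    Runs (.seq p q) s (T₁ + T₂) R := by
  obtain ⟨t₁, s₁, e₁, l₁, hq⟩ := h₁
  obtain ⟨t₂, s₂, e₂, l₂, hr⟩ := h₂ s₁ hq
  exact ⟨t₁ + t₂, s₂, .seq e₁ e₂, add_le_add l₁ l₂, hr⟩

theorem runs_skip {s : Store} {Q : Store → Prop} (h : Q s) : Runs .skip s 1 Q :=
  ⟨1, s, .skip s, le_rfl, h⟩

theorem runs_assign {x : ℕ} {e : Expr} {s : Store} {Q : Store → Prop}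
    (h : Q (s.setReg x (e.eval s))) : Runs (.assign x e) s (e.cost + 1) Q :=
  ⟨_, _, .assign x e s, le_rfl, h⟩

theorem runs_write {a : ℕ} {i e : Expr} {s : Store} {Q : Store → Prop}
    (h : Q (s.setArr a (i.eval s) (e.eval s))) : Runs (.write a i e) s (i.cost + e.cost + 1) Q :=
  ⟨_, _, .write a i e s, le_rfl, h⟩

theorem runs_branch {e : Expr} {p q : Program} {s : Store} {T₁ T₂ : ℕ} {Q : Store → Prop}
    (h₁ : e.eval s ≠ 0 → Runs p s T₁ Q) (h₂ : e.eval s = 0 → Runs q s T₂ Q) :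
    Runs (.branch e p q) s (e.cost + 1 + T₁ + T₂) Q := by
  by_cases h : e.eval s = 0
  · obtain ⟨t, s', he, ht, hs⟩ := h₂ h
    exact ⟨_, s', .branch_false h he, by omega, hs⟩
  · obtain ⟨t, s', he, ht, hs⟩ := h₁ h
    exact ⟨_, s', .branch_true h he, by omega, hs⟩

/-- A loop whose invariant `I j` counts the iterations, and of which at most `B` take place. -/
theorem runs_loop {e : Expr} {p : Program} {s : Store} {T : ℕ} (B : ℕ) (I : ℕ → Store → Prop)
    (h0 : I 0 s)
    (hstep : ∀ j s, I j s → e.eval s ≠ 0 → j < B ∧ Runs p s T (I (j + 1))) :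
    Runs (.loop e p) s (B * (e.cost + 1 + T) + (e.cost + 1))
      (fun s' => ∃ j, I j s' ∧ e.eval s' = 0) := by
  suffices H : ∀ k j s, j + k = B → I j s → Runs (.loop e p) s (k * (e.cost + 1 + T) + (e.cost + 1))
      (fun s' => ∃ j, I j s' ∧ e.eval s' = 0) from H B 0 s (by omega) h0
  intro k
  induction k with
  | zero =>
    intro j s hj hI
    by_cases h : e.eval s = 0
    · exact ⟨_, s, .loop_false h, by omega, j, hI, h⟩
    · exact absurd (hstep j s hI h).1 (by omega)
  | succ k ih =>
    intro j s hj hI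
    by_cases h : e.eval s = 0
    · exact ⟨_, s, .loop_false h, by omega, j, hI, h⟩
    · obtain ⟨-, t₁, s₁, e₁, l₁, h₁⟩ := hstep j s hI h
      obtain ⟨t₂, s₂, e₂, l₂, h₂⟩ := ih (j + 1) s₁ (by omega) h₁
      refine ⟨_, s₂, .loop_true h e₁ e₂, ?_, h₂⟩
      rw [Nat.succ_mul]
      omega

/-- `for i < n do p`, where `n` is the content of register `0`. -/
def forLoop (i : ℕ) (p : Program) : Program :=
  .seq (.assign i (.lit 0))
    (.loop (.sub (.reg 0) (.reg i)) (.seq p (.assign i (.add (.reg i) (.lit 1)))))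

theorem runs_forLoop {i : ℕ} {p : Program} {s : Store} {n T : ℕ} (I : ℕ → Store → Prop)
    (hi : i ≠ 0) (hn : s.reg 0 = n) (h0 : I 0 (s.setReg i 0))
    (hstep : ∀ j < n, ∀ s, I j s → s.reg i = j → s.reg 0 = n →
      Runs p s T (fun s' => s'.reg i = j ∧ s'.reg 0 = n ∧ I (j + 1) (s'.setReg i (j + 1)))) :
    Runs (forLoop i p) s (n * (T + 8) + 6) (fun s' => s'.reg 0 = n ∧ I n s') := by
  have key : Runs (forLoop i p) s (((Expr.lit 0).cost + 1) +
      (n * ((Expr.sub (.reg 0) (.reg i)).cost + 1 + (T + ((Expr.add (.reg i) (.lit 1)).cost + 1))) +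
        ((Expr.sub (.reg 0) (.reg i)).cost + 1))) (fun s' => s'.reg 0 = n ∧ I n s') := by
    refine Runs.seq (Q := fun s' => s' = s.setReg i 0) (runs_assign rfl) ?_
    rintro _ rfl
    refine (runs_loop n
      (fun j s => j ≤ n ∧ s.reg i = j ∧ s.reg 0 = n ∧ I j s) ?_ ?_).mono le_rfl ?_
    · exact ⟨Nat.zero_le _, by simp, by simp [hi.symm, hn], h0⟩
    · rintro j s ⟨-, hj, h0, hI⟩ hg
      have hlt : j < n := by
        simp only [Expr.eval, h0, hj] at hg
        omega
      refine ⟨hlt, Runs.seq (hstep j hlt s hI hj h0) ?_⟩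
      rintro s' ⟨hj', h0', hI'⟩
      refine runs_assign ⟨hlt, ?_, ?_, ?_⟩
      · simp [Expr.eval, hj']
      · simp [hi.symm, h0']
      · simpa [Expr.eval, hj'] using hI'
    · rintro s' ⟨j, ⟨hle, hj, h0, hI⟩, hg⟩
      simp only [Expr.eval, h0, hj] at hg
      obtain rfl : j = n := by omega
      exact ⟨h0, hI⟩
  refine key.mono (le_of_eq ?_) fun _ h => h
  simp only [Expr.cost]
  ring

/-! ### Bounded formulas as tests -/

/-- All registers that an expression reads satisfy `P`. -/
def Expr.regsIn (P : ℕ → Bool) : Expr → Bool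
  | .lit _ => true
  | .reg x => P x
  | .arr _ i => i.regsIn P
  | .add e₁ e₂ => e₁.regsIn P && e₂.regsIn P
  | .sub e₁ e₂ => e₁.regsIn P && e₂.regsIn P

theorem Expr.eval_congr {P : ℕ → Bool} {s s' : Store} (ha : s.arr = s'.arr)
    (hr : ∀ x, P x = true → s.reg x = s'.reg x) {e : Expr} (he : e.regsIn P = true) :
    e.eval s = e.eval s' := by
  induction e with
  | lit c => rfl
  | reg x => exact hr x he
  | arr a i ih => simp only [Expr.eval, ha, ih he]
  | add e₁ e₂ ih₁ ih₂ =>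
    simp only [Expr.regsIn, Bool.and_eq_true] at he
    simp only [Expr.eval, ih₁ he.1, ih₂ he.2]
  | sub e₁ e₂ ih₁ ih₂ =>
    simp only [Expr.regsIn, Bool.and_eq_true] at he
    simp only [Expr.eval, ih₁ he.1, ih₂ he.2]

/-- Formulas with quantifiers that range over the numbers below the content of register `0`. The
bound variables are registers. -/
inductive Formula : Type
  | nz (e : Expr)
  | neg (f : Formula)
  | conj (f g : Formula)
  | ex (i : ℕ) (f : Formula)

/-- The truth of a formula: `nz e` says that `e` is not `0`. -/
def Formula.Holds : Formula → Store → Prop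
  | .nz e, s => e.eval s ≠ 0
  | .neg f, s => ¬ f.Holds s
  | .conj f g, s => f.Holds s ∧ g.Holds s
  | .ex i f, s => ∃ j < s.reg 0, f.Holds (s.setReg i j)

/-- A program that puts the truth value of a formula into register `d`, using the registers from `d`
on as scratch space. -/
def Formula.code : Formula → ℕ → Program
  | .nz e, d => .branch e (.assign d (.lit 1)) (.assign d (.lit 0))
  | .neg f, d => .seq (f.code d) (.assign d (.sub (.lit 1) (.reg d)))
  | .conj f g, d => .seq (f.code d) (.seq (g.code (d + 1))
      (.assign d (.sub (.add (.reg d) (.reg (d + 1))) (.lit 1))))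
  | .ex i f, d => .seq (.assign d (.lit 0)) (forLoop i
      (.seq (f.code (d + 1)) (.branch (.reg (d + 1)) (.assign d (.lit 1)) .skip)))

/-- Free variables are registers below `100` or belong to `Γ`; bound variables are registers between
`100` and `200`, and no variable is bound twice on a branch. -/
def Formula.wf : List ℕ → Formula → Bool
  | Γ, .nz e => e.regsIn (fun x => decide (x < 100) || decide (x ∈ Γ))
  | Γ, .neg f => f.wf Γ
  | Γ, .conj f g => f.wf Γ && g.wf Γ
  | Γ, .ex i f => decide (100 ≤ i) && decide (i < 200) && !decide (i ∈ Γ) && f.wf (i :: Γ)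

open Polynomial in
/-- A bound for the time to evaluate a formula, as a polynomial in the content of register `0`. -/
noncomputable def Formula.time : Formula → Polynomial ℕ
  | .nz e => C (e.cost + 5)
  | .neg f => f.time + C 4
  | .conj f g => f.time + (g.time + C 6)
  | .ex _ f => C 2 + (X * (f.time + C 5 + C 8) + C 6)

open Classical in
/-- Stated for two memories `s` and `s'` that agree on the variables that may occur in `f`: in the
induction, the scratch registers of `s'` no longer have their initial content. -/
theorem Formula.runs_code {f : Formula} {Γ : List ℕ} (hf : f.wf Γ = true) (hΓ : ∀ x ∈ Γ, x < 200)
    {d : ℕ} (hd : 200 ≤ d) {s s' : Store} (ha : s.arr = s'.arr)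
    (hr : ∀ x, x < 100 ∨ x ∈ Γ → s.reg x = s'.reg x) :
    Runs (f.code d) s' (f.time.eval (s.reg 0)) (fun s'' => s''.arr = s'.arr ∧
      (∀ x, x < 100 ∨ x ∈ Γ ∨ 200 ≤ x ∧ x < d → s''.reg x = s'.reg x) ∧
      s''.reg d = if f.Holds s then 1 else 0) := by
  induction f generalizing Γ d s s' with
  | nz e =>
    have he : e.eval s = e.eval s' := Expr.eval_congr ha (fun x hx => hr x (by simpa using hx)) hf
    have hne : ∀ x, x < 100 ∨ x ∈ Γ ∨ 200 ≤ x ∧ x < d → x ≠ d := by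
      rintro x (h | h | h)
      · omega
      · have := hΓ x h
        omega
      · omega
    refine (runs_branch (T₁ := 2) (T₂ := 2) (fun h => runs_assign ?_)
      (fun h => runs_assign ?_)).mono ?_ fun _ h => h
    · refine ⟨rfl, fun x hx => ?_, ?_⟩
      · simp [hne x hx]
      · simp [Formula.Holds, he, h, Expr.eval]
    · refine ⟨rfl, fun x hx => ?_, ?_⟩
      · simp [hne x hx]
      · simp [Formula.Holds, he, h, Expr.eval]
    · simp [Formula.time]
  | neg f ih =>
    have hne : ∀ x, x < 100 ∨ x ∈ Γ ∨ 200 ≤ x ∧ x < d → x ≠ d := by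
      rintro x (h | h | h)
      · omega
      · have := hΓ x h
        omega
      · omega
    refine (Runs.seq (ih hf hΓ hd ha hr) ?_).mono (T := f.time.eval (s.reg 0) + 4)
      (by simp [Formula.time]) fun _ h => h
    rintro s'' ⟨h1, h2, h3⟩
    refine runs_assign ⟨h1, ?_, ?_⟩
    · intro x hx
      simp [hne x hx, h2 x hx]
    · by_cases h : f.Holds s <;> simp [Formula.Holds, Expr.eval, h3, h]
  | conj f g ihf ihg =>
    simp only [Formula.wf, Bool.and_eq_true] at hf
    have hne : ∀ x, x < 100 ∨ x ∈ Γ ∨ 200 ≤ x ∧ x < d → x ≠ d := by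
      rintro x (h | h | h)
      · omega
      · have := hΓ x h
        omega
      · omega
    refine (Runs.seq (ihf hf.1 hΓ hd ha hr) ?_).mono
      (T := f.time.eval (s.reg 0) + (g.time.eval (s.reg 0) + 6)) (by simp [Formula.time])
      fun _ h => h
    rintro s₁ ⟨h1, h2, h3⟩
    refine Runs.seq (ihg hf.2 hΓ (d := d + 1) (by omega) (s := s) (s' := s₁) (ha.trans h1.symm)
      fun x hx => (hr x hx).trans (h2 x (by tauto)).symm) ?_
    rintro s₂ ⟨k1, k2, k3⟩
    refine runs_assign ⟨k1.trans h1, ?_, ?_⟩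
    · intro x hx
      have : x < 100 ∨ x ∈ Γ ∨ 200 ≤ x ∧ x < d + 1 := by
        rcases hx with h | h | h
        · exact .inl h
        · exact .inr (.inl h)
        · exact .inr (.inr (by omega))
      simp [hne x hx, h2 x hx, k2 x this]
    · have hd' : s₂.reg d = s₁.reg d := k2 d (.inr (.inr ⟨hd, by omega⟩))
      by_cases h : f.Holds s <;> by_cases h' : g.Holds s <;>
        simp [Formula.Holds, Expr.eval, h3, k3, hd', h, h']
  | ex i f ih =>
    simp only [Formula.wf, Bool.and_eq_true, decide_eq_true_eq, Bool.not_eq_true',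
      decide_eq_false_iff_not] at hf
    obtain ⟨⟨⟨hi1, hi2⟩, hiΓ⟩, hf⟩ := hf
    have hne : ∀ x, x < 100 ∨ x ∈ Γ ∨ 200 ≤ x ∧ x < d → x ≠ d ∧ x ≠ i := by
      rintro x (h | h | h)
      · omega
      · have := hΓ x h
        exact ⟨by omega, fun h' => hiΓ (h' ▸ h)⟩
      · omega
    have h0 : s'.reg 0 = s.reg 0 := (hr 0 (by omega)).symm
    refine (Runs.seq (Q := fun s₁ => s₁ = s'.setReg d 0) (runs_assign rfl) ?_).mono
      (T := 2 + (s.reg 0 * (f.time.eval (s.reg 0) + 5 + 8) + 6)) (by simp [Formula.time])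
      fun _ h => h
    rintro _ rfl
    refine (runs_forLoop (n := s.reg 0) (I := fun j t => t.arr = s'.arr ∧
      (∀ x, x < 100 ∨ x ∈ Γ ∨ 200 ≤ x ∧ x < d → t.reg x = s'.reg x) ∧
      t.reg d = if ∃ k < j, f.Holds (s.setReg i k) then 1 else 0) (by omega) ?_ ?_ ?_).mono
      le_rfl ?_
    · simp [h0]
      omega
    · refine ⟨rfl, ?_, ?_⟩
      · intro x hx
        simp [hne x hx]
      · have : d ≠ i := by omega
        simp [this]
    · rintro j hj t ⟨t1, t2, t3⟩ tj t0
      refine (Runs.seq (ih (Γ := i :: Γ) hf ?_ (d := d + 1) (by omega)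
        (s := s.setReg i j) (s' := t) ?_ ?_) (T₂ := 5) ?_).mono
          (T := f.time.eval ((s.setReg i j).reg 0) + 5) ?_ fun _ h => h
      · intro x hx
        rcases List.mem_cons.1 hx with rfl | hx
        · exact hi2
        · exact hΓ x hx
      · simp [ha, t1]
      · intro x hx
        by_cases hxi : x = i
        · simp [hxi, tj]
        · have hx' : x < 100 ∨ x ∈ Γ := by
            rcases hx with h | h
            · exact .inl h
            · exact .inr ((List.mem_cons.1 h).resolve_left hxi)
          simp only [Store.setReg_reg, hxi, if_false]
          rw [hr x hx', t2 x (by tauto)]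
      · rintro t' ⟨u1, u2, u3⟩
        have ui : t'.reg i = j := by rw [u2 i (.inr (.inl (by simp))), tj]
        have u0 : t'.reg 0 = s.reg 0 := by rw [u2 0 (by omega), t0]
        have ux : ∀ x, x < 100 ∨ x ∈ Γ ∨ 200 ≤ x ∧ x < d → t'.reg x = s'.reg x := by
          intro x hx
          rw [u2 x, t2 x hx]
          rcases hx with h | h | h
          · exact .inl h
          · exact .inr (.inl (by simp [h]))
          · exact .inr (.inr (by omega))
        have ud : t'.reg d = t.reg d := u2 d (.inr (.inr ⟨hd, by omega⟩))
        have hdi : d ≠ i := by omega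
        have hlast : (∃ k < j + 1, f.Holds (s.setReg i k)) ↔
            (∃ k < j, f.Holds (s.setReg i k)) ∨ f.Holds (s.setReg i j) := by
          constructor
          · rintro ⟨k, hk, hh⟩
            rcases Nat.lt_succ_iff_lt_or_eq.1 hk with h | rfl
            · exact .inl ⟨k, h, hh⟩
            · exact .inr hh
          · rintro (⟨k, hk, hh⟩ | hh)
            · exact ⟨k, by omega, hh⟩
            · exact ⟨j, by omega, hh⟩
        have h0d : (0 : ℕ) ≠ d := by omega
        refine (runs_branch (T₁ := 2) (T₂ := 1) (fun h => runs_assign ?_)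
          (fun h => runs_skip ?_)).mono (by simp [Expr.cost]) fun _ h => h
        · have hh : f.Holds (s.setReg i j) := by
            by_contra h'
            exact h (by simp [Expr.eval, u3, h'])
          refine ⟨by simp [hdi.symm, ui], by simp [h0d, u0], u1.trans t1, fun x hx => ?_, ?_⟩
          · simp [hne x hx, ux x hx]
          · simp only [Store.setReg_reg, hdi, if_false, if_true, hlast, hh, or_true, Expr.eval]
        · have hh : ¬ f.Holds (s.setReg i j) := by
            intro h'
            simp [Expr.eval, u3, h'] at h
          refine ⟨ui, u0, u1.trans t1, fun x hx => ?_, ?_⟩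
          · simp [hne x hx, ux x hx]
          · simp only [Store.setReg_reg, hdi, if_false, hlast, hh, or_false, ud, t3]
      · have : (0 : ℕ) ≠ i := by omega
        simp [this]
    · rintro t ⟨-, t1, t2, t3⟩
      refine ⟨t1, t2, t3.trans ?_⟩
      simp only [Formula.Holds]
      congr

/-! ### Programs with bounded loops -/

/-- Programs whose tests are formulas and whose loops are bounded by the content of register `0`. -/
inductive BProg : Type
  | skip
  | assign (x : ℕ) (e : Expr)
  | write (a : ℕ) (i e : Expr)
  | seq (p q : BProg)
  | ite (f : Formula) (p q : BProg)
  | forBelow (i : ℕ) (p : BProg)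

/-- The memory after `j` iterations of a loop with index register `i` and body `f`. -/
def iter (i : ℕ) (f : Store → Store) (s : Store) : ℕ → Store
  | 0 => s.setReg i 0
  | j + 1 => (f (iter i f s j)).setReg i (j + 1)

open Classical in
/-- The meaning of a program as a total function on memories. -/
noncomputable def BProg.run : BProg → Store → Store
  | .skip, s => s
  | .assign x e, s => s.setReg x (e.eval s)
  | .write a i e, s => s.setArr a (i.eval s) (e.eval s)
  | .seq p q, s => q.run (p.run s)
  | .ite f p q, s => if f.Holds s then p.run s else q.run s
  | .forBelow i p, s => iter i p.run s (s.reg 0)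

theorem BProg.run_seq (p q : BProg) (s : Store) :
    (BProg.seq p q).run s = q.run (p.run s) := rfl

theorem BProg.run_assign (x : ℕ) (e : Expr) (s : Store) :
    (BProg.assign x e).run s = s.setReg x (e.eval s) := rfl

/-- The program of the machine; tests use the registers from `100` on as scratch space. -/
def BProg.code : BProg → Program
  | .skip => .skip
  | .assign x e => .assign x e
  | .write a i e => .write a i e
  | .seq p q => .seq p.code q.code
  | .ite f p q => .seq (f.code 200) (.branch (.reg 200) p.code q.code)
  | .forBelow i p => forLoop i p.code

/-- The registers to which a program assigns. -/
def BProg.regs : BProg → List ℕ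
  | .skip => []
  | .assign x _ => [x]
  | .write _ _ _ => []
  | .seq p q => p.regs ++ q.regs
  | .ite _ p q => p.regs ++ q.regs
  | .forBelow i p => i :: p.regs

/-- The arrays to which a program writes. -/
def BProg.arrs : BProg → List ℕ
  | .skip => []
  | .assign _ _ => []
  | .write a _ _ => [a]
  | .seq p q => p.arrs ++ q.arrs
  | .ite _ p q => p.arrs ++ q.arrs
  | .forBelow _ p => p.arrs

/-- A program does not touch the scratch registers, does not assign to register `0`, and does not
assign to the index register of a loop inside the loop. -/
def BProg.wf : BProg → Bool
  | .skip => true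
  | .assign x e => decide (x ≠ 0) && decide (x < 100) && e.regsIn (fun x => decide (x < 100))
  | .write _ i e => i.regsIn (fun x => decide (x < 100)) && e.regsIn (fun x => decide (x < 100))
  | .seq p q => p.wf && q.wf
  | .ite f p q => f.wf [] && p.wf && q.wf
  | .forBelow i p => decide (i ≠ 0) && decide (i < 100) && decide (i ∉ p.regs) && p.wf

open Polynomial in
/-- A bound for the running time, as a polynomial in the content of register `0`. -/
noncomputable def BProg.time : BProg → Polynomial ℕ
  | .skip => C 1
  | .assign _ e => C (e.cost + 1)
  | .write _ i e => C (i.cost + e.cost + 1)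
  | .seq p q => p.time + q.time
  | .ite f p q => f.time + (C 2 + p.time + q.time)
  | .forBelow _ p => X * (p.time + C 8) + C 6

theorem BProg.run_reg {p : BProg} {x : ℕ} (h : x ∉ p.regs) (s : Store) :
    (p.run s).reg x = s.reg x := by
  induction p generalizing s with
  | skip => rfl
  | assign y e =>
    simp only [BProg.regs, List.mem_singleton] at h
    simp [BProg.run, h]
  | write a i e => rfl
  | seq p q ihp ihq =>
    simp only [BProg.regs, List.mem_append, not_or] at h
    simp only [BProg.run, ihq h.2, ihp h.1]
  | ite f p q ihp ihq =>
    simp only [BProg.regs, List.mem_append, not_or] at h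
    simp only [BProg.run]
    split
    · exact ihp h.1 s
    · exact ihq h.2 s
  | forBelow i p ih =>
    simp only [BProg.regs, List.mem_cons, not_or] at h
    simp only [BProg.run]
    generalize s.reg 0 = n
    induction n with
    | zero => simp [iter, h.1]
    | succ n ihn => simp [iter, h.1, ih h.2, ihn]

theorem BProg.run_arr {p : BProg} {a : ℕ} (h : a ∉ p.arrs) (s : Store) :
    (p.run s).arr a = s.arr a := by
  induction p generalizing s with
  | skip => rfl
  | assign y e => rfl
  | write b i e =>
    simp only [BProg.arrs, List.mem_singleton] at h
    ext j
    simp [BProg.run, h]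
  | seq p q ihp ihq =>
    simp only [BProg.arrs, List.mem_append, not_or] at h
    simp only [BProg.run, ihq h.2, ihp h.1]
  | ite f p q ihp ihq =>
    simp only [BProg.arrs, List.mem_append, not_or] at h
    simp only [BProg.run]
    split
    · exact ihp h.1 s
    · exact ihq h.2 s
  | forBelow i p ih =>
    simp only [BProg.run]
    generalize s.reg 0 = n
    induction n with
    | zero => simp [iter]
    | succ n ihn =>
      simp only [iter, Store.setReg_arr]
      rw [ih h, ihn]

theorem BProg.wf_zero {p : BProg} (h : p.wf = true) : 0 ∉ p.regs := by
  induction p with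
  | skip => simp [BProg.regs]
  | assign x e =>
    simp only [BProg.wf, Bool.and_eq_true, decide_eq_true_eq] at h
    simpa [BProg.regs] using h.1.1.symm
  | write a i e => simp [BProg.regs]
  | seq p q ihp ihq =>
    simp only [BProg.wf, Bool.and_eq_true] at h
    simp [BProg.regs, ihp h.1, ihq h.2]
  | ite f p q ihp ihq =>
    simp only [BProg.wf, Bool.and_eq_true] at h
    simp [BProg.regs, ihp h.1.2, ihq h.2]
  | forBelow i p ih =>
    simp only [BProg.wf, Bool.and_eq_true, decide_eq_true_eq] at h
    simp [BProg.regs, ih h.2, h.1.1.1.symm]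

/-- Invariant rule for bounded loops. -/
theorem BProg.run_for {i : ℕ} {p : BProg} {s : Store} {n : ℕ} (hn : s.reg 0 = n)
    (hw : (BProg.forBelow i p).wf = true) (I : ℕ → Store → Prop) (h0 : I 0 (s.setReg i 0))
    (hstep : ∀ j < n, ∀ s, I j s → s.reg i = j → s.reg 0 = n →
      I (j + 1) ((p.run s).setReg i (j + 1))) : I n ((BProg.forBelow i p).run s) := by
  simp only [BProg.wf, Bool.and_eq_true, decide_eq_true_eq] at hw
  suffices H : ∀ j ≤ n, I j (iter i p.run s j) ∧ (iter i p.run s j).reg i = j ∧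
      (iter i p.run s j).reg 0 = n by
    simp only [BProg.run, hn]
    exact (H n le_rfl).1
  intro j
  induction j with
  | zero => exact fun _ => ⟨h0, by simp [iter], by simp [iter, hw.1.1.1.symm, hn]⟩
  | succ j ih =>
    intro hj
    obtain ⟨h1, h2, h3⟩ := ih (by omega)
    refine ⟨hstep j hj _ h1 h2 h3, by simp [iter], ?_⟩
    simp [iter, hw.1.1.1.symm, BProg.run_reg (BProg.wf_zero hw.2), h3]

/-- Two memories agree outside the scratch registers. -/
def Store.Agree (s s' : Store) : Prop :=
  s.arr = s'.arr ∧ ∀ x < 100, s.reg x = s'.reg x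

theorem Expr.eval_agree {s s' : Store} (h : s.Agree s') {e : Expr}
    (he : e.regsIn (fun x => decide (x < 100)) = true) : e.eval s = e.eval s' :=
  Expr.eval_congr h.1 (fun x hx => h.2 x (by simpa using hx)) he

theorem Store.Agree.setReg {s s' : Store} (h : s.Agree s') (x v : ℕ) :
    (s.setReg x v).Agree (s'.setReg x v) := by
  refine ⟨h.1, fun y hy => ?_⟩
  simp [h.2 y hy]

/-- The machine program computes the meaning of a bounded program, in polynomial time and up to the
scratch registers. -/
theorem BProg.runs_code {p : BProg} (hp : p.wf = true) {s s' : Store} (h : s.Agree s') :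
    Runs p.code s' (p.time.eval (s.reg 0)) (fun s'' => (p.run s).Agree s'') := by
  induction p generalizing s s' with
  | skip => exact (runs_skip h).mono (by simp [BProg.time]) fun _ h => h
  | assign x e =>
    simp only [BProg.wf, Bool.and_eq_true] at hp
    refine (runs_assign (Q := fun s'' => ((BProg.assign x e).run s).Agree s'') ?_).mono
      (by simp [BProg.time]) fun _ h => h
    rw [← Expr.eval_agree h hp.2]
    exact h.setReg _ _
  | write a i e =>
    simp only [BProg.wf, Bool.and_eq_true] at hp
    refine (runs_write (Q := fun s'' => ((BProg.write a i e).run s).Agree s'') ?_).mono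
      (by simp [BProg.time]) fun _ h => h
    rw [← Expr.eval_agree h hp.1, ← Expr.eval_agree h hp.2]
    refine ⟨?_, fun x hx => h.2 x hx⟩
    funext b j
    simp [BProg.run, h.1]
  | seq p q ihp ihq =>
    simp only [BProg.wf, Bool.and_eq_true] at hp
    refine (Runs.seq (ihp hp.1 h) fun s₁ h₁ => ihq hp.2 h₁).mono ?_ fun _ h => h
    simp [BProg.time, BProg.run_reg (BProg.wf_zero hp.1)]
  | ite f p q ihp ihq =>
    simp only [BProg.wf, Bool.and_eq_true] at hp
    refine (Runs.seq (Formula.runs_code hp.1.1 (by simp) (d := 200) le_rfl h.1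
      (fun x hx => h.2 x (by simpa using hx)))
      (T₂ := 2 + p.time.eval (s.reg 0) + q.time.eval (s.reg 0)) ?_).mono
      (by simp [BProg.time]) fun _ h => h
    rintro s₁ ⟨h1, h2, h3⟩
    have h₁ : s.Agree s₁ := ⟨h.1.trans h1.symm, fun x hx => (h.2 x hx).trans (h2 x (.inl hx)).symm⟩
    refine (runs_branch (fun hc => ?_) (fun hc => ?_)).mono le_rfl fun _ h => h
    · have : f.Holds s := by
        by_contra hn
        exact hc (by simp [Expr.eval, h3, hn])
      simpa [BProg.run, this] using ihp hp.1.2 h₁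
    · have : ¬ f.Holds s := by
        intro hn
        simp [Expr.eval, h3, hn] at hc
      simpa [BProg.run, this] using ihq hp.2 h₁
  | forBelow i p ih =>
    have hp' := hp
    simp only [BProg.wf, Bool.and_eq_true, decide_eq_true_eq] at hp
    have h00 : (0 : ℕ) ≠ i := hp.1.1.1.symm
    refine (runs_forLoop (n := s.reg 0) (T := p.time.eval (s.reg 0))
      (fun j t => (iter i p.run s j).Agree t ∧ (iter i p.run s j).reg 0 = s.reg 0) hp.1.1.1
      (h.2 0 (by norm_num)).symm ?_ ?_).mono (by simp [BProg.time]) ?_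
    · exact ⟨h.setReg _ _, by simp [iter, h00]⟩
    · rintro j hj t ⟨ht, ht0⟩ tj t0
      refine (ih hp.2 ht).mono (by rw [ht0]) ?_
      intro t' ht'
      have h0' : (p.run (iter i p.run s j)).reg 0 = s.reg 0 := by
        rw [BProg.run_reg (BProg.wf_zero hp.2), ht0]
      refine ⟨?_, ?_, ht'.setReg _ _, ?_⟩
      · rw [← ht'.2 i hp.1.1.2, BProg.run_reg hp.1.2, ht.2 i hp.1.1.2, tj]
      · rw [← ht'.2 0 (by norm_num), h0']
      · simp [iter, h00, h0']
    · rintro t ⟨-, ht, -⟩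
      exact ht

/-! ### Colourings with three labels and arc consistency -/

/-- The label `0` stands for the cutset, and `1` and `2` for the two sides: the labels that must not
be adjacent are exactly those with sum `0` modulo `3`. -/
def Proper (A : ℕ → ℕ → Prop) (σ : ℕ → Fin 3) : Prop :=
  ∀ u v, A u v → σ u + σ v ≠ 0

/-- A set `D` of pairs `(v, c)` lists the labels `c` that are still allowed at each vertex `v`. The
labelling `σ` obeys it. -/
def Within (n : ℕ) (σ : ℕ → Fin 3) (D : Finset (ℕ × Fin 3)) : Prop :=
  ∀ v < n, (v, σ v) ∈ D

/-- Some neighbour of `v` has no allowed label that is compatible with the label `c` at `v`. -/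
def Unsupported (A : ℕ → ℕ → Prop) (D : Finset (ℕ × Fin 3)) (v : ℕ) (c : Fin 3) : Prop :=
  ∃ w, A v w ∧ ∀ c', (w, c') ∈ D → c' = -c

/-- Every allowed label has a compatible allowed label at each neighbour. -/
def ArcConsistent (A : ℕ → ℕ → Prop) (D : Finset (ℕ × Fin 3)) : Prop :=
  ∀ v c, (v, c) ∈ D → ¬ Unsupported A D v c

/-- At most two labels are allowed at each vertex. -/
def TwoValued (n : ℕ) (D : Finset (ℕ × Fin 3)) : Prop :=
  ∀ v < n, ∃ c, (v, c) ∉ D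

/-- At most one label is allowed at `v`. -/
def SingleAt (D : Finset (ℕ × Fin 3)) (v : ℕ) : Prop :=
  ∀ c c', (v, c) ∈ D → (v, c') ∈ D → c = c'

theorem SingleAt.mono {D D' : Finset (ℕ × Fin 3)} {v : ℕ} (h : SingleAt D v) (hD : D' ⊆ D) :
    SingleAt D' v :=
  fun c c' hc hc' => h c c' (hD hc) (hD hc')

theorem TwoValued.mono {n : ℕ} {D D' : Finset (ℕ × Fin 3)} (h : TwoValued n D) (hD : D' ⊆ D) :
    TwoValued n D' := by
  intro v hv
  obtain ⟨c, hc⟩ := h v hv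
  exact ⟨c, fun h => hc (hD h)⟩

theorem fin3_cover : ∀ c₁ c₂ c₃ c : Fin 3, c₁ ≠ c₂ → c₃ ≠ c₁ → c₃ ≠ c₂ → c ≠ c₃ →
    c = c₁ ∨ c = c₂ := by
  decide

open Classical in
/-- The 2-SAT principle: if a solution obeys `D`, where at most two labels are allowed at each
vertex, then every arc consistent `D' ⊆ D` without empty domains is obeyed by some solution. At the
vertices where `D'` allows a single label, the old solution is overwritten by it; elsewhere `D'` allows
the same labels as `D`. -/
theorem exists_proper_within {A : ℕ → ℕ → Prop} {n : ℕ} (hA : ∀ u v, A u v → u < n ∧ v < n)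
    (hs : ∀ u v, A u v → A v u)
    {D D' : Finset (ℕ × Fin 3)} (h2 : TwoValued n D) (hsub : D' ⊆ D) (hac : ArcConsistent A D')
    (hne : ∀ v < n, ∃ c, (v, c) ∈ D') {σ : ℕ → Fin 3} (hσ : Proper A σ) (hσD : Within n σ D) :
    ∃ σ', Proper A σ' ∧ Within n σ' D' := by
  choose! f hf using hne
  let σ' : ℕ → Fin 3 := fun v => if SingleAt D' v then f v else σ v
  have hin : Within n σ' D' := by
    intro v hv
    by_cases h : SingleAt D' v
    · simpa [σ', h] using hf v hv
    · simp only [σ', h, if_false]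
      simp only [SingleAt, not_forall] at h
      obtain ⟨c₁, c₂, hc₁, hc₂, hne⟩ := h
      obtain ⟨c₃, hc₃⟩ := h2 v hv
      rcases fin3_cover c₁ c₂ c₃ (σ v) hne (fun h => hc₃ (h ▸ hsub hc₁))
        (fun h => hc₃ (h ▸ hsub hc₂)) (fun h => hc₃ (h ▸ hσD v hv)) with h | h
      · rwa [h]
      · rwa [h]
  have key : ∀ u v, A u v → SingleAt D' v → σ' u + σ' v ≠ 0 := by
    intro u v huv hv h0
    refine hac u (σ' u) (hin u (hA u v huv).1) ⟨v, huv, fun c' hc' => ?_⟩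
    rw [hv c' (σ' v) hc' (hin v (hA u v huv).2)]
    exact eq_neg_of_add_eq_zero_right h0
  refine ⟨σ', fun u v huv => ?_, hin⟩
  by_cases hv : SingleAt D' v
  · exact key u v huv hv
  by_cases hu : SingleAt D' u
  · rw [add_comm]
    exact key v u (hs u v huv) hu
  · simpa [σ', hu, hv] using hσ u v huv

open Classical in
/-- Forbid the label `c` at `v` if it is unsupported. -/
noncomputable def prune (A : ℕ → ℕ → Prop) (v : ℕ) (c : Fin 3) (D : Finset (ℕ × Fin 3)) :
    Finset (ℕ × Fin 3) :=
  if Unsupported A D v c then D.erase (v, c) else D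

/-- An operation that only forbids labels, and none that a solution uses. -/
structure IsPruning (A : ℕ → ℕ → Prop) (n : ℕ) (F : Finset (ℕ × Fin 3) → Finset (ℕ × Fin 3)) :
    Prop where
  subset : ∀ D, F D ⊆ D
  within : ∀ D σ, Proper A σ → Within n σ D → Within n σ (F D)

theorem IsPruning.comp {A : ℕ → ℕ → Prop} {n : ℕ}
    {F F' : Finset (ℕ × Fin 3) → Finset (ℕ × Fin 3)} (h : IsPruning A n F)
    (h' : IsPruning A n F') : IsPruning A n (fun D => F' (F D)) where
  subset D := (h'.subset _).trans (h.subset D)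
  within D σ hσ hD := h'.within _ σ hσ (h.within D σ hσ hD)

theorem isPruning_prune {A : ℕ → ℕ → Prop} {n : ℕ} (hA : ∀ u v, A u v → u < n ∧ v < n) (v : ℕ)
    (c : Fin 3) : IsPruning A n (prune A v c) where
  subset D := by
    unfold prune
    split
    · exact Finset.erase_subset _ _
    · exact subset_rfl
  within D σ hσ hD := by
    unfold prune
    split
    · rename_i h
      obtain ⟨w, hw, hc⟩ := h
      intro u hu
      refine Finset.mem_erase.2 ⟨fun he => ?_, hD u hu⟩
      obtain ⟨rfl, rfl⟩ := Prod.ext_iff.1 he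
      refine hσ _ _ hw ?_
      simp only at hc ⊢
      rw [hc _ (hD w (hA _ _ hw).2)]
      exact add_neg_cancel _
    · exact hD

theorem not_unsupported_of_prune_eq {A : ℕ → ℕ → Prop} {v : ℕ} {c : Fin 3}
    {D : Finset (ℕ × Fin 3)} (h : prune A v c D = D) (hc : (v, c) ∈ D) :
    ¬ Unsupported A D v c := by
  intro hu
  rw [prune, if_pos hu] at h
  rw [← h] at hc
  simp at hc

/-- Prune all three labels at `v`. -/
noncomputable def pruneAt (A : ℕ → ℕ → Prop) (v : ℕ) (D : Finset (ℕ × Fin 3)) :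
    Finset (ℕ × Fin 3) :=
  prune A v 2 (prune A v 1 (prune A v 0 D))

/-- Prune all labels at the vertices below `k` in turn. -/
noncomputable def sweep (A : ℕ → ℕ → Prop) : ℕ → Finset (ℕ × Fin 3) → Finset (ℕ × Fin 3)
  | 0, D => D
  | k + 1, D => pruneAt A k (sweep A k D)

theorem isPruning_pruneAt {A : ℕ → ℕ → Prop} {n : ℕ} (hA : ∀ u v, A u v → u < n ∧ v < n) (v : ℕ) :
    IsPruning A n (pruneAt A v) :=
  ((isPruning_prune hA v 0).comp (isPruning_prune hA v 1)).comp (isPruning_prune hA v 2)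

theorem isPruning_sweep {A : ℕ → ℕ → Prop} {n : ℕ} (hA : ∀ u v, A u v → u < n ∧ v < n) (k : ℕ) :
    IsPruning A n (sweep A k) := by
  induction k with
  | zero => exact ⟨fun D => subset_rfl, fun D σ _ h => h⟩
  | succ k ih => exact ih.comp (isPruning_pruneAt hA k)

theorem not_unsupported_of_pruneAt_eq {A : ℕ → ℕ → Prop} {n : ℕ}
    (hA : ∀ u v, A u v → u < n ∧ v < n) {v : ℕ} {D : Finset (ℕ × Fin 3)}
    (h : pruneAt A v D = D) (c : Fin 3) (hc : (v, c) ∈ D) : ¬ Unsupported A D v c := by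
  have s1 := (isPruning_prune hA v 0).subset D
  have s2 := (isPruning_prune hA v 1).subset (prune A v 0 D)
  have s3 := (isPruning_prune hA v 2).subset (prune A v 1 (prune A v 0 D))
  unfold pruneAt at h
  have e1 : prune A v 0 D = D := s1.antisymm (by rw [h] at s3; exact s3.trans s2)
  rw [e1] at h s2 s3
  have e2 : prune A v 1 D = D := s2.antisymm (by rw [h] at s3; exact s3)
  rw [e2] at h
  fin_cases c
  · exact not_unsupported_of_prune_eq e1 hc
  · exact not_unsupported_of_prune_eq e2 hc
  · exact not_unsupported_of_prune_eq h hc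

theorem not_unsupported_of_sweep_eq {A : ℕ → ℕ → Prop} {n : ℕ}
    (hA : ∀ u v, A u v → u < n ∧ v < n) {k : ℕ} {D : Finset (ℕ × Fin 3)} (h : sweep A k D = D)
    {v : ℕ} (hv : v < k) (c : Fin 3) (hc : (v, c) ∈ D) : ¬ Unsupported A D v c := by
  induction k with
  | zero => omega
  | succ k ih =>
    have s1 := (isPruning_sweep hA k).subset D
    have s2 := (isPruning_pruneAt hA k).subset (sweep A k D)
    rw [sweep] at h
    have e1 : sweep A k D = D := s1.antisymm (by rw [h] at s2; exact s2)
    rw [e1] at h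
    rcases Nat.lt_succ_iff_lt_or_eq.1 hv with hv | rfl
    · exact ih e1 hv
    · exact not_unsupported_of_pruneAt_eq hA h c hc

/-- A shrinking operation reaches a fixed point after as many steps as there are elements. -/
theorem iterate_fixed_of_subset {α : Type*} {F : Finset α → Finset α} (hF : ∀ D, F D ⊆ D) :
    ∀ (m : ℕ) (D : Finset α), D.card ≤ m → F (F^[m] D) = F^[m] D := by
  intro m
  induction m with
  | zero =>
    intro D hD
    have : D = ∅ := Finset.card_eq_zero.1 (by omega)
    subst this
    exact Finset.subset_empty.1 (hF ∅)
  | succ m ih =>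
    intro D hD
    by_cases h : F D = D
    · rw [Function.iterate_fixed h]
      exact h
    · have := Finset.card_lt_card ((hF D).ssubset_of_ne h)
      exact ih (F D) (by omega)

theorem isPruning_iterate {A : ℕ → ℕ → Prop} {n : ℕ}
    {F : Finset (ℕ × Fin 3) → Finset (ℕ × Fin 3)} (h : IsPruning A n F) (m : ℕ) :
    IsPruning A n F^[m] := by
  induction m with
  | zero => exact ⟨fun D => subset_rfl, fun D σ _ h => h⟩
  | succ m ih =>
    rw [Function.iterate_succ']
    exact ih.comp h

theorem arcConsistent_iterate_sweep {A : ℕ → ℕ → Prop} {n : ℕ}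
    (hA : ∀ u v, A u v → u < n ∧ v < n) {D : Finset (ℕ × Fin 3)}
    (hD : D ⊆ Finset.range n ×ˢ Finset.univ) : ArcConsistent A ((sweep A n)^[3 * n] D) := by
  intro v c hc
  refine not_unsupported_of_sweep_eq hA (k := n) ?_ ?_ c hc
  · refine iterate_fixed_of_subset (isPruning_sweep hA n).subset _ _ ?_
    refine (Finset.card_le_card hD).trans ?_
    simp [mul_comm]
  · have := hD ((isPruning_iterate (isPruning_sweep hA n) _).subset _ hc)
    simpa using this

/-! ### Branching on triangles -/

/-- The vertices `x`, `y`, `z` form a triangle. -/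
def Tri (A : ℕ → ℕ → Prop) (x y z : ℕ) : Prop := A x y ∧ A y z ∧ A x z

/-- Every triangle meets `X`. -/
def Hits (A : ℕ → ℕ → Prop) (X : Set ℕ) : Prop :=
  ∀ x y z, Tri A x y z → x ∈ X ∨ y ∈ X ∨ z ∈ X

/-- The vertex of a triple that a ternary digit selects. -/
def pick (c x y z : ℕ) : ℕ := if c = 0 then x else if c = 1 then y else z

open Classical in
/-- If `t` is a triangle that `L` does not meet, append the vertex of `t` that the next digit of `C`
selects. -/
noncomputable def hitStep (A : ℕ → ℕ → Prop) (C : ℕ → ℕ) (L : List ℕ) (t : ℕ × ℕ × ℕ) : List ℕ :=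
  if Tri A t.1 t.2.1 t.2.2 ∧ t.1 ∉ L ∧ t.2.1 ∉ L ∧ t.2.2 ∉ L then
    L ++ [pick (C L.length) t.1 t.2.1 t.2.2]
  else L

/-- Go through all triples once and hit the triangles among them, guided by the digits `C`. -/
noncomputable def hitList (A : ℕ → ℕ → Prop) (n : ℕ) (C : ℕ → ℕ) : List ℕ :=
  (List.range n).foldl (fun L x => (List.range n).foldl (fun L y =>
    (List.range n).foldl (fun L z => hitStep A C L (x, y, z)) L) L) []

theorem hitList_eq (A : ℕ → ℕ → Prop) (n : ℕ) (C : ℕ → ℕ) :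
    hitList A n C = ((List.range n).flatMap fun x => (List.range n).flatMap fun y =>
      (List.range n).map fun z => (x, y, z)).foldl (hitStep A C) [] := by
  simp only [hitList, List.foldl_flatMap, List.foldl_map]

theorem mem_hitStep {A : ℕ → ℕ → Prop} {C : ℕ → ℕ} {L : List ℕ} {t : ℕ × ℕ × ℕ} {v : ℕ}
    (h : v ∈ L) : v ∈ hitStep A C L t := by
  unfold hitStep
  split <;> simp [h]

theorem mem_foldl_hitStep {A : ℕ → ℕ → Prop} {C : ℕ → ℕ} {T : List (ℕ × ℕ × ℕ)} {L : List ℕ}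
    {v : ℕ} (h : v ∈ L) : v ∈ T.foldl (hitStep A C) L := by
  induction T generalizing L with
  | nil => exact h
  | cons t T ih => exact ih (mem_hitStep h)

theorem pick_mem (c x y z : ℕ) : pick c x y z = x ∨ pick c x y z = y ∨ pick c x y z = z := by
  unfold pick
  split_ifs <;> simp

theorem foldl_hitStep_hits {A : ℕ → ℕ → Prop} {C : ℕ → ℕ} {T : List (ℕ × ℕ × ℕ)} {L : List ℕ}
    {x y z : ℕ} (ht : (x, y, z) ∈ T) (h : Tri A x y z) :
    x ∈ T.foldl (hitStep A C) L ∨ y ∈ T.foldl (hitStep A C) L ∨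
      z ∈ T.foldl (hitStep A C) L := by
  induction T generalizing L with
  | nil => simp at ht
  | cons t T ih =>
    rcases List.mem_cons.1 ht with rfl | ht
    · have : x ∈ hitStep A C L (x, y, z) ∨ y ∈ hitStep A C L (x, y, z) ∨
          z ∈ hitStep A C L (x, y, z) := by
        unfold hitStep
        split
        · rcases pick_mem (C L.length) x y z with e | e | e <;> simp [e]
        · rename_i hn
          simp only [h, true_and] at hn
          tauto
      rw [List.foldl_cons]
      exact this.imp mem_foldl_hitStep (Or.imp mem_foldl_hitStep mem_foldl_hitStep)
    · exact ih ht

theorem hits_hitList {A : ℕ → ℕ → Prop} {n : ℕ} (hA : ∀ u v, A u v → u < n ∧ v < n)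
    (C : ℕ → ℕ) : Hits A {v | v ∈ hitList A n C} := by
  intro x y z h
  rw [hitList_eq]
  refine foldl_hitStep_hits ?_ h
  simp [(hA x y h.1).1, (hA x y h.1).2, (hA y z h.2.1).2]

/-- Each time a triangle is met, some digit selects a vertex of the given hitting set `X`. -/
theorem exists_digits_foldl {A : ℕ → ℕ → Prop} {X : Finset ℕ} (hX : Hits A X)
    (T : List (ℕ × ℕ × ℕ)) (L : List ℕ) (hL : L.Nodup) (hLX : ∀ v ∈ L, v ∈ X) :
    ∃ d : ℕ → Fin 3, ∀ C : ℕ → ℕ, (∀ i, L.length ≤ i → i < X.card → C i = (d i).val) →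
      (T.foldl (hitStep A C) L).length ≤ X.card := by
  have hcard : ∀ L : List ℕ, L.Nodup → (∀ v ∈ L, v ∈ X) → L.length ≤ X.card := by
    intro L hL hLX
    rw [← List.toFinset_card_of_nodup hL]
    exact Finset.card_le_card fun v hv => hLX v (by simpa using hv)
  induction T generalizing L with
  | nil => exact ⟨0, fun C _ => hcard L hL hLX⟩
  | cons t T ih =>
    by_cases ht : Tri A t.1 t.2.1 t.2.2 ∧ t.1 ∉ L ∧ t.2.1 ∉ L ∧ t.2.2 ∉ L
    · obtain ⟨c, hcX, hcL⟩ : ∃ c : Fin 3, pick c.val t.1 t.2.1 t.2.2 ∈ X ∧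
          pick c.val t.1 t.2.1 t.2.2 ∉ L := by
        rcases hX _ _ _ ht.1 with h | h | h
        · exact ⟨0, by simpa [pick] using h, by simpa [pick] using ht.2.1⟩
        · exact ⟨1, by simpa [pick] using h, by simpa [pick] using ht.2.2.1⟩
        · exact ⟨2, by simpa [pick] using h, by simpa [pick] using ht.2.2.2⟩
      have hnd : (L ++ [pick c.val t.1 t.2.1 t.2.2]).Nodup := by
        rw [List.nodup_append]
        refine ⟨hL, by simp, ?_⟩
        rintro a ha b hb rfl
        exact hcL (by simpa using (List.mem_singleton.1 hb) ▸ ha)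
      have hsub : ∀ v ∈ L ++ [pick c.val t.1 t.2.1 t.2.2], v ∈ X := by
        intro v hv
        rcases List.mem_append.1 hv with hv | hv
        · exact hLX v hv
        · rwa [List.mem_singleton.1 hv]
      obtain ⟨d, hd⟩ := ih _ hnd hsub
      have hlen := hcard _ hnd hsub
      simp only [List.length_append, List.length_singleton] at hd hlen
      refine ⟨Function.update d L.length c, fun C hC => ?_⟩
      have hCL : C L.length = c.val := by
        rw [hC _ le_rfl (by omega)]
        simp
      rw [List.foldl_cons, hitStep, if_pos ht, hCL]
      refine hd C fun i hi hi' => ?_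
      rw [hC i (by omega) hi', Function.update_of_ne (by omega)]
    · obtain ⟨d, hd⟩ := ih L hL hLX
      refine ⟨d, fun C hC => ?_⟩
      rw [List.foldl_cons, hitStep, if_neg ht]
      exact hd C hC

theorem exists_digits_hitList {A : ℕ → ℕ → Prop} (n : ℕ) {X : Finset ℕ} (hX : Hits A X) :
    ∃ d : ℕ → Fin 3, ∀ C : ℕ → ℕ, (∀ i < X.card, C i = (d i).val) →
      (hitList A n C).length ≤ X.card := by
  obtain ⟨d, hd⟩ := exists_digits_foldl hX ((List.range n).flatMap fun x =>
    (List.range n).flatMap fun y => (List.range n).map fun z => (x, y, z)) [] (by simp) (by simp)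
  refine ⟨d, fun C hC => ?_⟩
  rw [hitList_eq]
  exact hd C fun i _ hi => hC i hi

/-- Every sequence of `k` ternary digits is that of some number below `3 ^ k`. -/
theorem exists_nat_digits (k : ℕ) (d : ℕ → Fin 3) :
    ∃ m < 3 ^ k, ∀ i < k, m / 3 ^ i % 3 = (d i).val := by
  induction k generalizing d with
  | zero => exact ⟨0, by simp, by simp⟩
  | succ k ih =>
    obtain ⟨m, hm, hd⟩ := ih fun i => d (i + 1)
    refine ⟨3 * m + (d 0).val, ?_, ?_⟩
    · have := (d 0).isLt
      rw [pow_succ]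
      omega
    · have h0 := (d 0).isLt
      rintro (_ | i) hi
      · simp
      · rw [pow_succ', ← Nat.div_div_eq_div_mul, show (3 * m + (d 0).val) / 3 = m by omega]
        exact hd i (by omega)

/-! ### Independent cutsets -/

/-- The adjacency relation of `G` as a relation on natural numbers. -/
def adjNat {n : ℕ} (G : SimpleGraph (Fin n)) (i j : ℕ) : Prop :=
  ∃ (hi : i < n) (hj : j < n), G.Adj ⟨i, hi⟩ ⟨j, hj⟩

theorem adjNat_lt {n : ℕ} (G : SimpleGraph (Fin n)) (u v : ℕ) (h : adjNat G u v) :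
    u < n ∧ v < n :=
  ⟨h.1, h.2.1⟩

theorem adjNat_symm {n : ℕ} (G : SimpleGraph (Fin n)) (u v : ℕ) (h : adjNat G u v) :
    adjNat G v u :=
  ⟨h.2.1, h.1, h.2.2.symm⟩

theorem adjNat_ne {n : ℕ} (G : SimpleGraph (Fin n)) (u v : ℕ) (h : adjNat G u v) : u ≠ v := by
  rintro rfl
  exact h.2.2.ne rfl

theorem adjNat_val {n : ℕ} {G : SimpleGraph (Fin n)} {u v : Fin n} :
    adjNat G u v ↔ G.Adj u v :=
  ⟨fun h => h.2.2, fun h => ⟨u.2, v.2, h⟩⟩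

/-- A set `P` of vertices that is closed under adjacency outside `S` witnesses that `S` is a
cutset. -/
theorem isCutset_of_closed {V : Type*} {G : SimpleGraph V} {S : Set V} (P : V → Prop) {a b : V}
    (ha : a ∉ S) (hb : b ∉ S) (hPa : P a) (hPb : ¬ P b)
    (hP : ∀ u w, w ∉ S → G.Adj u w → P u → P w) : IsCutset G S := by
  intro hc
  obtain ⟨p⟩ := hc ⟨a, ha⟩ ⟨b, hb⟩
  have : ∀ {x y : (Sᶜ : Set V)}, (G.induce Sᶜ).Walk x y → P x → P y := by
    intro x y q
    induction q with
    | nil => exact id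
    | @cons u v w h _ ih => exact fun hx => ih (hP u.1 v.1 v.2 h hx)
  exact hPb (this p hPa)

/-- The neighbourhood of a vertex in no triangle is an independent cutset, unless the vertex is
adjacent to all others. -/
theorem isIndependentCutset_neighborhood {n : ℕ} {G : SimpleGraph (Fin n)} {v u : ℕ} (hv : v < n)
    (hu : u < n) (huv : u ≠ v) (hA : ¬ adjNat G v u) (hT : ∀ y z, ¬ Tri (adjNat G) v y z) :
    IsIndependentCutset G {w : Fin n | adjNat G v w} := by
  constructor
  · intro x hx y hy _ hxy
    exact hT x y ⟨hx, adjNat_val.2 hxy, hy⟩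
  · refine isCutset_of_closed (fun w => w = ⟨v, hv⟩) (a := ⟨v, hv⟩) (b := ⟨u, hu⟩) ?_ hA rfl ?_ ?_
    · exact fun h => adjNat_ne G v v h rfl
    · simpa using huv
    · rintro x w hw hxw rfl
      exact absurd (adjNat_val.2 hxw) hw

/-- The test at the end of the algorithm is sound even where several labels are allowed: outside the
vertices that allow `0`, those that allow `1` are closed under adjacency. -/
theorem isIndependentCutset_of_labels {n : ℕ} {G : SimpleGraph (Fin n)} {D : Finset (ℕ × Fin 3)}
    {a b : ℕ} (ha : a < n) (hb : b < n) (hne : ∀ v < n, ∃ c, (v, c) ∈ D)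
    (hD : ∀ u w, adjNat G u w → ∀ c, (u, c) ∈ D → (w, -c) ∉ D)
    (ha0 : (a, 0) ∉ D) (ha2 : (a, 2) ∉ D) (hb0 : (b, 0) ∉ D) (hb1 : (b, 1) ∉ D) :
    IsIndependentCutset G {v : Fin n | (v.val, (0 : Fin 3)) ∈ D} := by
  constructor
  · intro x hx y hy _ hxy
    exact hD x y (adjNat_val.2 hxy) 0 hx hy
  · refine isCutset_of_closed (fun w => (w.val, (1 : Fin 3)) ∈ D) (a := ⟨a, ha⟩) (b := ⟨b, hb⟩)
      ha0 hb0 ?_ hb1 ?_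
    · obtain ⟨c, hc⟩ := hne a ha
      fin_cases c
      · exact absurd hc ha0
      · exact hc
      · exact absurd hc ha2
    · intro u w hw huw hu
      have h2 := hD u w (adjNat_val.2 huw) 1 hu
      obtain ⟨c, hc⟩ := hne w w.2
      fin_cases c
      · exact absurd hc hw
      · exact hc
      · exact absurd hc h2

open Classical in
/-- The labelling of an independent cutset: one side is a component, the other side is the rest. -/
theorem exists_proper_of_isIndependentCutset {n : ℕ} {G : SimpleGraph (Fin n)} {S : Set (Fin n)}
    (h : IsIndependentCutset G S) :
    ∃ (σ : ℕ → Fin 3) (a b : ℕ), a < n ∧ b < n ∧ Proper (adjNat G) σ ∧ σ a = 1 ∧ σ b = 2 := by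
  obtain ⟨hi, hc⟩ := h
  simp only [IsCutset, SimpleGraph.Preconnected, not_forall] at hc
  obtain ⟨a, b, hab⟩ := hc
  let σ : ℕ → Fin 3 := fun v => if hv : v < n then
    if hS : (⟨v, hv⟩ : Fin n) ∈ S then 0
    else if (G.induce Sᶜ).Reachable a ⟨⟨v, hv⟩, hS⟩ then 1 else 2 else 0
  have hσ : ∀ v : Fin n, σ v = if hS : v ∈ S then 0
      else if (G.induce Sᶜ).Reachable a ⟨v, hS⟩ then 1 else 2 := fun v => by simp [σ]
  refine ⟨σ, a.1, b.1, a.1.2, b.1.2, ?_, ?_, ?_⟩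
  · rintro u v ⟨hu, hv, huv⟩
    have e1 := hσ ⟨u, hu⟩
    have e2 := hσ ⟨v, hv⟩
    simp only at e1 e2
    rw [e1, e2]
    by_cases h1 : (⟨u, hu⟩ : Fin n) ∈ S <;> by_cases h2 : (⟨v, hv⟩ : Fin n) ∈ S
    · exact absurd huv (hi h1 h2 huv.ne)
    · simp only [h1, h2, dif_pos, dif_neg, not_false_eq_true]
      split <;> decide
    · simp only [h1, h2, dif_pos, dif_neg, not_false_eq_true]
      split <;> decide
    · simp only [h1, h2, dif_neg, not_false_eq_true]
      have hadj : (G.induce Sᶜ).Adj ⟨⟨u, hu⟩, h1⟩ ⟨⟨v, hv⟩, h2⟩ := huv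
      have : (G.induce Sᶜ).Reachable a ⟨⟨u, hu⟩, h1⟩ ↔
          (G.induce Sᶜ).Reachable a ⟨⟨v, hv⟩, h2⟩ :=
        ⟨fun h => h.trans hadj.reachable, fun h => h.trans hadj.symm.reachable⟩
      simp only [this]
      split <;> decide
  · rw [hσ]
    simp [show a.1 ∉ S from a.2]
  · rw [hσ]
    simp only [show b.1 ∉ S from b.2, dif_neg, not_false_eq_true]
    rw [if_neg hab]

/-- If no neighbourhood is an independent cutset and the graph is not complete, every vertex lies in
a triangle: a vertex `v` in no triangle is adjacent to all others, and then every other vertex has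
`v` as its only neighbour. -/
theorem exists_tri_of_no_neighborhood {A : ℕ → ℕ → Prop} {n : ℕ}
    (hlt : ∀ u v, A u v → u < n ∧ v < n)
    (h : ∀ v < n, (∃ u < n, u ≠ v ∧ ¬ A v u) → ∃ y z, Tri A v y z)
    {a b : ℕ} (ha : a < n) (hb : b < n) (hab : a ≠ b) (hA : ¬ A a b) :
    ∀ v < n, ∃ y z, Tri A v y z := by
  intro v hv
  by_cases hu : ∃ u < n, u ≠ v ∧ ¬ A v u
  · exact h v hv hu
  have hall : ∀ u < n, u ≠ v → A v u := by
    intro u hu' huv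
    by_contra hc
    exact hu ⟨u, hu', huv, hc⟩
  have hav : a ≠ v := by
    rintro rfl
    exact hA (hall b hb hab.symm)
  have hva := hall a ha hav
  obtain ⟨y, z, h1, h2, h3⟩ := h a ha ⟨b, hb, hab.symm, hA⟩
  by_cases hy : y = v
  · subst hy
    exact ⟨a, z, hva, h3, h2⟩
  · exact ⟨a, y, hva, h1, hall y (hlt _ _ h1).2 hy⟩

/-! ### The two parameters -/

theorem triangleHittingNumber_le_oddCycleTransversalNumber {V : Type*} [Fintype V]
    (G : SimpleGraph V) : triangleHittingNumber G ≤ oddCycleTransversalNumber G := by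
  obtain ⟨X, hX, hc⟩ := exists_card_eq_oddCycleTransversalNumber G
  refine Nat.sInf_le ⟨X, ?_, hc⟩
  exact SimpleGraph.Colorable.cliqueFree hX (by norm_num)

theorem exists_hits_card_eq {n : ℕ} (G : SimpleGraph (Fin n)) :
    ∃ X : Finset ℕ, Hits (adjNat G) X ∧ X.card = triangleHittingNumber G ∧ X.card ≤ n := by
  obtain ⟨X, hX, hc⟩ := exists_card_eq_triangleHittingNumber G
  refine ⟨X.map Fin.valEmbedding, ?_, by simpa using hc, ?_⟩
  · rintro x y z ⟨⟨hx, hy, hxy⟩, ⟨_, hz, hyz⟩, ⟨_, _, hxz⟩⟩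
    by_contra hn
    simp only [Finset.coe_map, Fin.valEmbedding_apply, Set.mem_image, Finset.mem_coe, not_or,
      not_exists, not_and] at hn
    have h1 : (⟨x, hx⟩ : Fin n) ∉ X := fun h => hn.1 _ h rfl
    have h2 : (⟨y, hy⟩ : Fin n) ∉ X := fun h => hn.2.1 _ h rfl
    have h3 : (⟨z, hz⟩ : Fin n) ∉ X := fun h => hn.2.2 _ h rfl
    refine hX {⟨⟨x, hx⟩, by simpa using h1⟩, ⟨⟨y, hy⟩, by simpa using h2⟩,
      ⟨⟨z, hz⟩, by simpa using h3⟩} ?_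
    rw [SimpleGraph.is3Clique_triple_iff]
    exact ⟨hxy, hxz, hyz⟩
  · rw [Finset.card_map]
    simpa using X.card_le_univ

theorem triangleHittingNumber_le_length {n : ℕ} {G : SimpleGraph (Fin n)} {L : List ℕ}
    (hL : Hits (adjNat G) {v | v ∈ L}) : triangleHittingNumber G ≤ L.length := by
  classical
  let X : Finset (Fin n) := Finset.univ.filter fun v => v.val ∈ L
  have hX : IsTriangleHittingSet G (X : Set (Fin n)) := by
    intro t ht
    obtain ⟨x, y, z, hxy, hxz, hyz, -⟩ := SimpleGraph.is3Clique_iff.1 ht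
    have hm : ∀ w : ((X : Set (Fin n))ᶜ : Set (Fin n)), w.1.val ∉ L := by
      intro w hw
      exact w.2 (by simp [X, hw])
    rcases hL x.1 y.1 z.1 ⟨adjNat_val.2 hxy, adjNat_val.2 hyz, adjNat_val.2 hxz⟩ with h | h | h
    · exact hm x h
    · exact hm y h
    · exact hm z h
  have h1 : triangleHittingNumber G ≤ X.card := Nat.sInf_le ⟨X, hX, rfl⟩
  refine h1.trans ?_
  calc X.card = (X.map Fin.valEmbedding).card := (Finset.card_map _).symm
    _ ≤ L.toFinset.card := Finset.card_le_card fun v hv => by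
        simp only [Finset.mem_map, X, Finset.mem_filter] at hv
        obtain ⟨w, ⟨-, hw⟩, rfl⟩ := hv
        simpa using hw
    _ ≤ L.length := L.toFinset_card_le

/-! ### Common parts of the programs -/

/-- The expression with value `1` if `e = f` and `0` otherwise. -/
def eqE (e f : Expr) : Expr := .sub (.lit 1) (.add (.sub e f) (.sub f e))

@[simp] theorem eval_eqE (e f : Expr) (s : Store) :
    (eqE e f).eval s = if e.eval s = f.eval s then 1 else 0 := by
  simp only [eqE, Expr.eval]
  split <;> omega

/-- The entry of the adjacency matrix for the vertices in the registers `x` and `y`. Array `2` holds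
the offsets of the rows, since the machine cannot multiply. -/
def adjE (x y : ℕ) : Expr := .arr 0 (.add (.arr 2 (.reg x)) (.reg y))

/-- The formula that says `e = 0`. -/
def zeroF (e : Expr) : Formula := .neg (.nz e)

@[simp] theorem holds_zeroF (e : Expr) (s : Store) : (zeroF e).Holds s ↔ e.eval s = 0 := by
  simp [zeroF, Formula.Holds]

/-- One program for each of the three labels. -/
def each (f : Fin 3 → BProg) : BProg := .seq (f 0) (.seq (f 1) (f 2))

/-- The arrays that stay fixed give access to the adjacency relation `A` and to the powers of
`3`. -/
structure Env (n : ℕ) (A : ℕ → ℕ → Prop) (M : ℕ → ℕ → ℕ) : Prop where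
  adj : ∀ i < n, ∀ j < n, (M 0 (M 2 i + j) ≠ 0 ↔ A i j)
  pow : ∀ i ≤ n, M 3 i = 3 ^ i

theorem Env.congr {n : ℕ} {A : ℕ → ℕ → Prop} {M M' : ℕ → ℕ → ℕ} (h : Env n A M)
    (h0 : M' 0 = M 0) (h2 : M' 2 = M 2) (h3 : M' 3 = M 3) : Env n A M' where
  adj := by rw [h0, h2]; exact h.adj
  pow := by rw [h3]; exact h.pow

theorem Env.run {n : ℕ} {A : ℕ → ℕ → Prop} {s : Store} {p : BProg} (h : Env n A s.arr)
    (hp : 0 ∉ p.arrs ∧ 2 ∉ p.arrs ∧ 3 ∉ p.arrs) : Env n A (p.run s).arr :=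
  h.congr (BProg.run_arr hp.1 s) (BProg.run_arr hp.2.1 s) (BProg.run_arr hp.2.2 s)

theorem Env.eval_adjE {n : ℕ} {A : ℕ → ℕ → Prop} {s : Store} (h : Env n A s.arr) {x y : ℕ}
    (hx : s.reg x < n) (hy : s.reg y < n) :
    (adjE x y).eval s ≠ 0 ↔ A (s.reg x) (s.reg y) :=
  h.adj _ hx _ hy

/-- The allowed labels that are stored in the arrays `b`, `b + 1`, `b + 2`. -/
def dom (n b : ℕ) (M : ℕ → ℕ → ℕ) : Finset (ℕ × Fin 3) :=
  (Finset.range n ×ˢ Finset.univ).filter fun x => M (b + x.2.val) x.1 ≠ 0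

theorem mem_dom {n b : ℕ} {M : ℕ → ℕ → ℕ} {v : ℕ} {c : Fin 3} :
    (v, c) ∈ dom n b M ↔ v < n ∧ M (b + c.val) v ≠ 0 := by
  simp [dom]

theorem dom_congr {n b : ℕ} {M M' : ℕ → ℕ → ℕ} (h : ∀ c : Fin 3, M' (b + c.val) = M (b + c.val)) :
    dom n b M' = dom n b M := by
  simp only [dom, h]

theorem dom_run {n b : ℕ} {p : BProg} (h : ∀ c : Fin 3, b + c.val ∉ p.arrs) (s : Store) :
    dom n b (p.run s).arr = dom n b s.arr :=
  dom_congr fun c => BProg.run_arr (h c) s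

theorem dom_setArr_zero {n b v : ℕ} {c : Fin 3} {s : Store} :
    dom n b (s.setArr (b + c.val) v 0).arr = (dom n b s.arr).erase (v, c) := by
  ext ⟨u, c'⟩
  simp only [mem_dom, Finset.mem_erase, Store.setArr_arr, Nat.add_left_cancel_iff, ne_eq,
    Prod.mk.injEq, Fin.ext_iff]
  split_ifs with h <;> tauto

/-! ### Programs for arc consistency -/

/-- Forbid the label `c` at the vertex in register `10` if it is unsupported. -/
def pruneP (c : Fin 3) : BProg :=
  .ite (.ex 100 (.conj (.nz (adjE 10 100))
      (.conj (zeroF (.arr (10 + (-c + 1).val) (.reg 100)))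
        (zeroF (.arr (10 + (-c + 2).val) (.reg 100))))))
    (.write (10 + c.val) (.reg 10) (.lit 0)) .skip

theorem forall_eq_neg_iff (P : Fin 3 → Prop) (c : Fin 3) :
    (∀ c', P c' → c' = -c) ↔ ¬ P (-c + 1) ∧ ¬ P (-c + 2) := by
  have h : ∀ c c' : Fin 3, (c' = -c ∨ c' = -c + 1 ∨ c' = -c + 2) ∧ -c + 1 ≠ -c ∧ -c + 2 ≠ -c := by
    decide
  constructor
  · exact fun hP => ⟨fun h' => (h c 0).2.1 (hP _ h'), fun h' => (h c 0).2.2 (hP _ h')⟩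
  · rintro ⟨h1, h2⟩ c' hc'
    rcases (h c c').1 with rfl | rfl | rfl
    · rfl
    · exact absurd hc' h1
    · exact absurd hc' h2

theorem dom_pruneP {n : ℕ} {A : ℕ → ℕ → Prop} {s : Store} (hA : ∀ u v, A u v → u < n ∧ v < n)
    (hE : Env n A s.arr) (h0 : s.reg 0 = n) (hv : s.reg 10 < n) (c : Fin 3) :
    dom n 10 ((pruneP c).run s).arr = prune A (s.reg 10) c (dom n 10 s.arr) := by
  have hU : Formula.Holds (.ex 100 (.conj (.nz (adjE 10 100))
      (.conj (zeroF (.arr (10 + (-c + 1).val) (.reg 100)))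
        (zeroF (.arr (10 + (-c + 2).val) (.reg 100)))))) s ↔
      Unsupported A (dom n 10 s.arr) (s.reg 10) c := by
    simp only [Formula.Holds, holds_zeroF, Expr.eval, Store.setReg_reg, Store.setReg_arr, if_true,
      h0, Unsupported]
    constructor
    · rintro ⟨w, hw, ha, h1, h2⟩
      refine ⟨w, ?_, ?_⟩
      · have := (Env.eval_adjE (s := s.setReg 100 w) hE (x := 10) (y := 100) (by simpa using hv)
          (by simpa using hw)).1 ha
        simpa using this
      · rw [forall_eq_neg_iff (fun c' => (w, c') ∈ dom n 10 s.arr)]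
        simp [mem_dom, h1, h2]
    · rintro ⟨w, ha, h⟩
      have hw := (hA _ _ ha).2
      rw [forall_eq_neg_iff (fun c' => (w, c') ∈ dom n 10 s.arr)] at h
      simp only [mem_dom, hw, true_and, not_not] at h
      refine ⟨w, hw, ?_, h⟩
      refine (Env.eval_adjE (s := s.setReg 100 w) hE (x := 10) (y := 100) (by simpa using hv)
          (by simpa using hw)).2 (by simpa using ha)
  by_cases h : Unsupported A (dom n 10 s.arr) (s.reg 10) c
  · rw [prune, if_pos h, pruneP, BProg.run, if_pos (hU.2 h)]
    exact dom_setArr_zero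
  · rw [prune, if_neg h, pruneP, BProg.run, if_neg (fun h' => h (hU.1 h'))]
    rfl

/-- One pass of pruning over all vertices. -/
def sweepP : BProg := .forBelow 10 (each pruneP)

theorem dom_sweepP {n : ℕ} {A : ℕ → ℕ → Prop} {s : Store} (hA : ∀ u v, A u v → u < n ∧ v < n)
    (hE : Env n A s.arr) (h0 : s.reg 0 = n) :
    dom n 10 (sweepP.run s).arr = sweep A n (dom n 10 s.arr) := by
  refine (BProg.run_for (i := 10) h0 (by decide)
    (fun j t => Env n A t.arr ∧ dom n 10 t.arr = sweep A j (dom n 10 s.arr)) ⟨hE, rfl⟩ ?_).2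
  rintro j hj t ⟨tE, tD⟩ tj t0
  refine ⟨tE.run (by decide), ?_⟩
  simp only [each, BProg.run, Store.setReg_arr]
  have r1 : ∀ c s x, x < 100 → ((pruneP c).run s).reg x = s.reg x := by
    intro c s x _
    exact BProg.run_reg (by simp [pruneP, BProg.regs]) s
  have E1 : Env n A ((pruneP 0).run t).arr := tE.run (by decide)
  have E2 : Env n A ((pruneP 1).run ((pruneP 0).run t)).arr := E1.run (by decide)
  rw [dom_pruneP hA E2 (by simp [r1, t0]) (by simp [r1, tj, hj]),
    dom_pruneP hA E1 (by simp [r1, t0]) (by simp [r1, tj, hj]),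
    dom_pruneP hA tE (by simp [t0]) (by simp [tj, hj]), tD]
  simp [r1, tj, sweep, pruneAt]

/-- Enough passes to reach arc consistency. -/
def acP : BProg := .forBelow 11 (.seq sweepP (.seq sweepP sweepP))

theorem dom_acP {n : ℕ} {A : ℕ → ℕ → Prop} {s : Store} (hA : ∀ u v, A u v → u < n ∧ v < n)
    (hE : Env n A s.arr) (h0 : s.reg 0 = n) :
    dom n 10 (acP.run s).arr = (sweep A n)^[3 * n] (dom n 10 s.arr) := by
  refine (BProg.run_for (i := 11) h0 (by decide)
    (fun j t => Env n A t.arr ∧ dom n 10 t.arr = (sweep A n)^[3 * j] (dom n 10 s.arr))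
    ⟨hE, rfl⟩ ?_).2
  rintro j hj t ⟨tE, tD⟩ tj t0
  refine ⟨tE.run (by decide), ?_⟩
  have E1 : Env n A (sweepP.run t).arr := tE.run (by decide)
  have E2 : Env n A (sweepP.run (sweepP.run t)).arr := E1.run (by decide)
  have r1 : (sweepP.run t).reg 0 = n := (BProg.run_reg (by decide) t).trans t0
  have r2 : (sweepP.run (sweepP.run t)).reg 0 = n := (BProg.run_reg (by decide) _).trans r1
  simp only [BProg.run, Store.setReg_arr]
  rw [dom_sweepP hA E2 r2, dom_sweepP hA E1 r1, dom_sweepP hA tE t0, tD,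
    show 3 * (j + 1) = 3 * j + 1 + 1 + 1 by ring]
  simp only [Function.iterate_succ_apply']

theorem dom_subset_product (n b : ℕ) (M : ℕ → ℕ → ℕ) :
    dom n b M ⊆ Finset.range n ×ˢ Finset.univ :=
  Finset.filter_subset _ _

theorem acP_spec {n : ℕ} {A : ℕ → ℕ → Prop} {s : Store} (hA : ∀ u v, A u v → u < n ∧ v < n)
    (hE : Env n A s.arr) (h0 : s.reg 0 = n) :
    dom n 10 (acP.run s).arr ⊆ dom n 10 s.arr ∧ ArcConsistent A (dom n 10 (acP.run s).arr) ∧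
      ∀ σ, Proper A σ → Within n σ (dom n 10 s.arr) → Within n σ (dom n 10 (acP.run s).arr) := by
  rw [dom_acP hA hE h0]
  have h := isPruning_iterate (isPruning_sweep hA n) (3 * n)
  exact ⟨h.subset _, arcConsistent_iterate_sweep hA (dom_subset_product _ _ _), h.within _⟩

/-- Copy the allowed labels from the arrays `b`, `b + 1`, `b + 2` to `b'`, `b' + 1`, `b' + 2`. -/
def copyP (b b' : ℕ) : BProg :=
  .forBelow 13 (each fun c => .write (b' + c.val) (.reg 13) (.arr (b + c.val) (.reg 13)))

theorem dom_copyP {n b b' : ℕ} {s : Store} (h0 : s.reg 0 = n) (hb : b + 3 ≤ b' ∨ b' + 3 ≤ b) :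
    dom n b' ((copyP b b').run s).arr = dom n b s.arr := by
  have key : ∀ u < n, ∀ c : Fin 3,
      ((copyP b b').run s).arr (b' + c.val) u = s.arr (b + c.val) u := by
    refine (BProg.run_for (i := 13) (I := fun j t =>
      (∀ c : Fin 3, t.arr (b + c.val) = s.arr (b + c.val)) ∧
      ∀ u < j, ∀ c : Fin 3, t.arr (b' + c.val) u = s.arr (b + c.val) u) h0 rfl
      ⟨fun c => rfl, by simp⟩ ?_).2
    rintro j hj t ⟨t1, t2⟩ tj t0
    simp only [each, BProg.run, Store.setReg_arr, Expr.eval, Store.setArr_reg, tj]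
    have e0 := congrFun (t1 0) j
    have e1 := congrFun (t1 1) j
    have e2 := congrFun (t1 2) j
    simp only [Fin.val_zero, Fin.val_one, Fin.val_two, add_zero] at e0 e1 e2
    refine ⟨fun c => ?_, fun u hu c => ?_⟩
    · ext i
      have := c.isLt
      rw [← t1 c]
      simp only [Store.setArr_arr]
      rw [if_neg, if_neg, if_neg] <;> simp <;> omega
    · rcases Nat.lt_succ_iff_lt_or_eq.1 hu with hu | rfl
      · rw [← t2 u hu c]
        simp only [Store.setArr_arr]
        rw [if_neg, if_neg, if_neg] <;> simp <;> omega
      · have h1 : b + 1 ≠ b' := by omega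
        have h2 : b + 2 ≠ b' := by omega
        have h3 : b + 2 ≠ b' + 1 := by omega
        fin_cases c <;> simp [h1, h2, h3, e0, e1, e2]
  ext ⟨u, c⟩
  simp only [mem_dom]
  exact and_congr_right fun hu => by rw [key u hu c]

/-- Allow exactly the label in register `k` at the vertex in register `x`. -/
def fixP (x k : ℕ) : BProg :=
  each fun c => .write (10 + c.val) (.reg x) (eqE (.reg k) (.lit c.val))

theorem mem_dom_fixP {n x k : ℕ} {s : Store} {u : ℕ} {c : Fin 3} :
    (u, c) ∈ dom n 10 ((fixP x k).run s).arr ↔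
      u < n ∧ if u = s.reg x then c.val = s.reg k else (u, c) ∈ dom n 10 s.arr := by
  rw [mem_dom]
  refine and_congr_right fun hu => ?_
  by_cases h : u = s.reg x
  · fin_cases c <;>
      simp [fixP, each, BProg.run, Expr.eval, h, eq_comm]
  · simp only [h, if_false, mem_dom, hu, true_and]
    fin_cases c <;> simp [fixP, each, BProg.run, Expr.eval, h]

theorem within_fixP {n x k : ℕ} {s : Store} {σ : ℕ → Fin 3}
    (h : Within n σ (dom n 10 s.arr)) (hk : s.reg k = (σ (s.reg x)).val) :
    Within n σ (dom n 10 ((fixP x k).run s).arr) := by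
  intro v hv
  rw [mem_dom_fixP]
  refine ⟨hv, ?_⟩
  split
  · rename_i e
    rw [hk, e]
  · exact h v hv

theorem singleAt_fixP {n x k : ℕ} {s : Store} {v : ℕ}
    (h : v = s.reg x ∨ SingleAt (dom n 10 s.arr) v) :
    SingleAt (dom n 10 ((fixP x k).run s).arr) v := by
  intro c c' hc hc'
  rw [mem_dom_fixP] at hc hc'
  by_cases e : v = s.reg x
  · simp only [e, if_true] at hc hc'
    exact Fin.ext (hc.2.trans hc'.2.symm)
  · simp only [e, if_false] at hc hc'
    exact h.resolve_left e c c' hc.2 hc'.2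

/-- Some vertex has no allowed label in the arrays `b`, `b + 1`, `b + 2`. -/
def emptyF (b : ℕ) : Formula :=
  .ex 100 (.conj (zeroF (.arr b (.reg 100)))
    (.conj (zeroF (.arr (b + 1) (.reg 100))) (zeroF (.arr (b + 2) (.reg 100)))))

theorem not_holds_emptyF {n b : ℕ} {s : Store} (h0 : s.reg 0 = n) :
    ¬ (emptyF b).Holds s ↔ ∀ v < n, ∃ c, (v, c) ∈ dom n b s.arr := by
  simp only [emptyF, Formula.Holds, holds_zeroF, Expr.eval, Store.setReg_reg, Store.setReg_arr,
    if_true, h0, not_exists, not_and, mem_dom]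
  refine forall_congr' fun v => forall_congr' fun hv => ?_
  rw [Fin.exists_fin_succ, Fin.exists_fin_two]
  simp [hv]
  tauto

/-! ### Extending a consistent domain to a solution -/

/-- Unless register `8` is set, try to give the label `c` to the vertex in register `12`. -/
def tryP (c : Fin 3) : BProg :=
  .ite (.conj (zeroF (.reg 8)) (.nz (.arr (13 + c.val) (.reg 12))))
    (.seq (copyP 13 10) (.seq (.assign 4 (.lit c.val)) (.seq (fixP 12 4) (.seq acP
      (.ite (emptyF 10) .skip (.seq (copyP 10 13) (.assign 8 (.lit 1))))))))
    .skip

/-- Arc consistent domains with at most two labels at each vertex that some solution obeys: the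
invariant of the greedy algorithm. -/
def Solvable (A : ℕ → ℕ → Prop) (n : ℕ) (D : Finset (ℕ × Fin 3)) : Prop :=
  TwoValued n D ∧ ArcConsistent A D ∧ ∃ σ, Proper A σ ∧ Within n σ D

theorem tryP_regs (c : Fin 3) : (tryP c).regs = (tryP 0).regs := rfl

theorem tryP_reg {c : Fin 3} {x : ℕ} (h : x ∉ (tryP 0).regs) (s : Store) :
    ((tryP c).run s).reg x = s.reg x :=
  BProg.run_reg (by rwa [tryP_regs]) s

theorem tryP_skip {c : Fin 3} {s : Store} (h : s.reg 8 ≠ 0) : (tryP c).run s = s := by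
  simp [tryP, BProg.run, Formula.Holds, Expr.eval, h]

theorem Env.run_tryP {n : ℕ} {A : ℕ → ℕ → Prop} {s : Store} (h : Env n A s.arr) (c : Fin 3) :
    Env n A ((tryP c).run s).arr := by
  refine h.run ?_
  revert c
  decide

open Classical in
/-- Either the label `c` is impossible at the vertex and the domains in the arrays `13` to `15` stay
as they were, or the vertex gets a single label and the domains remain solvable, which is due to
`exists_proper_within`. -/
theorem tryP_spec {n : ℕ} {A : ℕ → ℕ → Prop} {s : Store} (hA : ∀ u v, A u v → u < n ∧ v < n)
    (hs : ∀ u v, A u v → A v u) (hE : Env n A s.arr) (h0 : s.reg 0 = n) (hv : s.reg 12 < n)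
    (h8 : s.reg 8 = 0) (hD : Solvable A n (dom n 13 s.arr)) (c : Fin 3) :
    (((tryP c).run s).reg 8 = 0 ∧ dom n 13 ((tryP c).run s).arr = dom n 13 s.arr ∧
      ∀ σ, Proper A σ → Within n σ (dom n 13 s.arr) → σ (s.reg 12) ≠ c) ∨
    (((tryP c).run s).reg 8 = 1 ∧ dom n 13 ((tryP c).run s).arr ⊆ dom n 13 s.arr ∧
      Solvable A n (dom n 13 ((tryP c).run s).arr) ∧
      SingleAt (dom n 13 ((tryP c).run s).arr) (s.reg 12)) := by
  by_cases hc : s.arr (13 + c.val) (s.reg 12) = 0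
  · left
    have : (tryP c).run s = s := by
      simp [tryP, BProg.run, Formula.Holds, Expr.eval, hc]
    rw [this]
    refine ⟨h8, rfl, ?_⟩
    rintro σ - hσ rfl
    exact (mem_dom.1 (hσ _ hv)).2 hc
  set s₁ := (copyP 13 10).run s with hs₁
  set s₂ := s₁.setReg 4 c.val with hs₂
  set s₃ := (fixP 12 4).run s₂ with hs₃
  set s₄ := acP.run s₃ with hs₄
  have hrun : (tryP c).run s = if (emptyF 10).Holds s₄ then s₄ else
      ((copyP 10 13).run s₄).setReg 8 1 := by
    simp only [tryP, BProg.run, Formula.Holds, holds_zeroF, Expr.eval, h8, hc, true_and, if_true,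
      ne_eq, not_false_eq_true]
    rfl
  have hreg : ∀ x, x ∉ acP.regs → x ≠ 4 → x ∉ (copyP 13 10).regs → s₄.reg x = s.reg x := by
    intro x h1 h2 h3
    rw [hs₄, BProg.run_reg h1, hs₃, BProg.run_reg (by simp [fixP, each, BProg.regs]), hs₂,
      Store.setReg_reg, if_neg h2, hs₁, BProg.run_reg h3]
  have E1 : Env n A s₁.arr := hE.run (by decide)
  have E3 : Env n A s₃.arr := Env.run (s := s₂) (p := fixP 12 4) E1 (by decide)
  have d2 : dom n 10 s₂.arr = dom n 13 s.arr := dom_copyP h0 (by omega)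
  have r3 : s₃.reg 0 = n := by
    rw [hs₃, BProg.run_reg (by decide), hs₂, Store.setReg_reg, if_neg (by decide), hs₁,
      BProg.run_reg (by decide), h0]
  have v2 : s₂.reg 12 = s.reg 12 := by
    rw [hs₂, Store.setReg_reg, if_neg (by decide), hs₁, BProg.run_reg (by decide)]
  have k2 : s₂.reg 4 = c.val := by simp [hs₂]
  obtain ⟨a1, a2, a3⟩ := acP_spec hA E3 r3
  have hsub : dom n 10 s₃.arr ⊆ dom n 13 s.arr := by
    rintro ⟨u, c'⟩ hu
    rw [hs₃, mem_dom_fixP] at hu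
    rw [d2, v2, k2] at hu
    by_cases e : u = s.reg 12
    · rw [if_pos e] at hu
      rw [mem_dom, e, hu.2]
      exact ⟨hv, hc⟩
    · rw [if_neg e] at hu
      exact hu.2
  have r4 : s₄.reg 0 = n := (hreg 0 (by decide) (by decide) (by decide)).trans h0
  by_cases he : (emptyF 10).Holds s₄
  · left
    rw [hrun, if_pos he]
    refine ⟨(hreg 8 (by decide) (by decide) (by decide)).trans h8, ?_, ?_⟩
    · rw [hs₄, dom_run (by decide), hs₃, dom_run (by decide)]
      exact dom_run (by decide) s
    · intro σ hσ hσD hσc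
      have w3 : Within n σ (dom n 10 s₃.arr) := by
        refine within_fixP (by rwa [d2]) ?_
        rw [k2, v2, hσc]
      exact (not_holds_emptyF r4).2 (fun v hv => ⟨σ v, a3 σ hσ w3 v hv⟩) he
  · right
    rw [hrun, if_neg he]
    have d5 : dom n 13 (((copyP 10 13).run s₄).setReg 8 1).arr = dom n 10 s₄.arr :=
      dom_copyP r4 (by omega)
    rw [d5]
    obtain ⟨t1, t2, σ, hσ, hσD⟩ := hD
    refine ⟨by simp, a1.trans hsub, ⟨t1.mono (a1.trans hsub), a2, ?_⟩, ?_⟩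
    · exact exists_proper_within hA hs t1 (a1.trans hsub) a2 ((not_holds_emptyF r4).1 he) hσ hσD
    · exact SingleAt.mono (singleAt_fixP (.inl v2.symm)) a1

/-- Fix the labels of all vertices in turn. -/
def solveP : BProg := .forBelow 12 (.seq (.assign 8 (.lit 0)) (each tryP))

/-- As the domains remain solvable, one of the three labels succeeds at each vertex. -/
theorem solveP_spec {n : ℕ} {A : ℕ → ℕ → Prop} {s : Store} (hA : ∀ u v, A u v → u < n ∧ v < n)
    (hs : ∀ u v, A u v → A v u) (hE : Env n A s.arr) (h0 : s.reg 0 = n)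
    (hD : Solvable A n (dom n 13 s.arr)) :
    dom n 13 (solveP.run s).arr ⊆ dom n 13 s.arr ∧ Solvable A n (dom n 13 (solveP.run s).arr) ∧
      ∀ v < n, SingleAt (dom n 13 (solveP.run s).arr) v := by
  refine (BProg.run_for (i := 12) h0 (by decide) (fun j t => Env n A t.arr ∧
    dom n 13 t.arr ⊆ dom n 13 s.arr ∧ Solvable A n (dom n 13 t.arr) ∧
    ∀ v < j, SingleAt (dom n 13 t.arr) v) ⟨hE, subset_rfl, hD, by simp⟩ ?_).2
  rintro j hj t ⟨tE, t1, t2, t3⟩ tj t0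
  suffices H : ∀ t' : Store, t' = (BProg.seq (.assign 8 (.lit 0)) (each tryP)).run t →
      dom n 13 t'.arr ⊆ dom n 13 t.arr ∧ Solvable A n (dom n 13 t'.arr) ∧
      SingleAt (dom n 13 t'.arr) j by
    obtain ⟨h1, h2, h3⟩ := H _ rfl
    refine ⟨tE.run (by decide), h1.trans t1, h2, fun v hv => ?_⟩
    rcases Nat.lt_succ_iff_lt_or_eq.1 hv with hv | rfl
    · exact (t3 v hv).mono h1
    · exact h3
  intro t' ht'
  simp only [each, BProg.run, Expr.eval] at ht'
  set u₀ := t.setReg 8 0 with hu₀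
  set u₁ := (tryP 0).run u₀ with hu₁
  set u₂ := (tryP 1).run u₁ with hu₂
  have E0 : Env n A u₀.arr := tE
  have E1 : Env n A u₁.arr := E0.run_tryP 0
  have E2 : Env n A u₂.arr := E1.run_tryP 1
  have z0 : u₀.reg 0 = n := by simp [hu₀, t0]
  have z1 : u₁.reg 0 = n := (tryP_reg (by decide) _).trans z0
  have z2 : u₂.reg 0 = n := (tryP_reg (by decide) _).trans z1
  have j0 : u₀.reg 12 = j := by simp [hu₀, tj]
  have j1 : u₁.reg 12 = j := (tryP_reg (by decide) _).trans j0
  have j2 : u₂.reg 12 = j := (tryP_reg (by decide) _).trans j1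
  have d0 : dom n 13 u₀.arr = dom n 13 t.arr := rfl
  rcases tryP_spec hA hs E0 z0 (by rwa [j0]) (by simp [hu₀]) (by rwa [d0]) 0 with
    ⟨g1, e1, f1⟩ | ⟨g1, k1⟩
  · rw [← hu₁] at g1 e1
    rw [j0, d0] at f1
    rw [d0] at e1
    rcases tryP_spec hA hs E1 z1 (by rwa [j1]) g1 (by rwa [e1]) 1 with
      ⟨g2, e2, f2⟩ | ⟨g2, k2⟩
    · rw [← hu₂] at g2 e2
      rw [j1, e1] at f2
      rw [e1] at e2
      rcases tryP_spec hA hs E2 z2 (by rwa [j2]) g2 (by rwa [e2]) 2 with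
        ⟨-, -, f3⟩ | ⟨-, k3⟩
      · exfalso
        rw [j2, e2] at f3
        obtain ⟨-, -, σ, hσ, hσD⟩ := t2
        have h3 : ∀ c : Fin 3, c = 0 ∨ c = 1 ∨ c = 2 := by decide
        rcases h3 (σ j) with h | h | h
        · exact f1 σ hσ hσD h
        · exact f2 σ hσ hσD h
        · exact f3 σ hσ hσD h
      · rw [← ht', e2, j2] at k3
        exact k3
    · rw [← hu₂, e1, j1] at k2
      rw [← hu₂] at g2
      rw [ht', tryP_skip (by rw [g2]; decide)]
      exact k2
  · rw [← hu₁, d0, j0] at k1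
    rw [← hu₁] at g1
    have e2 : u₂ = u₁ := tryP_skip (by rw [g1]; decide)
    rw [ht', e2, tryP_skip (by rw [g1]; decide)]
    exact k1

/-! ### Trying one guess -/

/-- The initial domains: the `i`-th vertex of array `7` gets the label that the `i`-th digit of
array `4` prescribes, the vertices in registers `15` and `16` get the labels `1` and `2`, and
everything else is allowed. -/
def guessP : BProg :=
  .seq (.forBelow 13 (each fun c => .write (10 + c.val) (.reg 13) (.lit 1)))
  (.seq (.forBelow 13 (.ite (.nz (.sub (.reg 3) (.reg 13)))
    (.seq (.assign 6 (.arr 7 (.reg 13))) (.seq (.assign 4 (.arr 4 (.reg 13))) (fixP 6 4))) .skip))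
  (.seq (.assign 4 (.lit 1)) (.seq (fixP 15 4) (.seq (.assign 4 (.lit 2)) (fixP 16 4)))))

theorem guessP_spec {n : ℕ} {s : Store} {σ : ℕ → Fin 3} (h0 : s.reg 0 = n) (h3 : s.reg 3 ≤ n)
    (hC : ∀ i < s.reg 3, s.arr 4 i = (σ (s.arr 7 i)).val) (ha : σ (s.reg 15) = 1)
    (hb : σ (s.reg 16) = 2) :
    Within n σ (dom n 10 (guessP.run s).arr) ∧
      ∀ v, (v = s.reg 15 ∨ v = s.reg 16 ∨ ∃ i < s.reg 3, v = s.arr 7 i) →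
        SingleAt (dom n 10 (guessP.run s).arr) v := by
  simp only [guessP, BProg.run_seq]
  set p₁ : BProg := .forBelow 13 (each fun c => .write (10 + c.val) (.reg 13) (.lit 1)) with hp₁
  set p₂ : BProg := .forBelow 13 (.ite (.nz (.sub (.reg 3) (.reg 13)))
    (.seq (.assign 6 (.arr 7 (.reg 13))) (.seq (.assign 4 (.arr 4 (.reg 13))) (fixP 6 4)))
    .skip) with hp₂
  set s₁ := p₁.run s with hs₁
  set s₂ := p₂.run s₁ with hs₂
  have f1 : s₁.reg 0 = n := (BProg.run_reg (by decide) s).trans h0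
  have f3 : s₁.reg 3 = s.reg 3 := BProg.run_reg (by decide) s
  have f4 : s₁.arr 4 = s.arr 4 := BProg.run_arr (by decide) s
  have f7 : s₁.arr 7 = s.arr 7 := BProg.run_arr (by decide) s
  have f15 : s₁.reg 15 = s.reg 15 := BProg.run_reg (by decide) s
  have f16 : s₁.reg 16 = s.reg 16 := BProg.run_reg (by decide) s
  have all1 : ∀ u < n, ∀ c : Fin 3, s₁.arr (10 + c.val) u = 1 := by
    refine BProg.run_for (i := 13) h0 (by decide)
      (fun j t => ∀ u < j, ∀ c : Fin 3, t.arr (10 + c.val) u = 1) (by simp) ?_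
    intro j hj t ht tj t0 u hu c
    rcases Nat.lt_succ_iff_lt_or_eq.1 hu with hu | rfl
    · have hne : u ≠ j := by omega
      have := ht u hu c
      fin_cases c <;> simpa [each, BProg.run, Expr.eval, tj, hne] using this
    · fin_cases c <;> simp [each, BProg.run, Expr.eval, tj]
  have w1 : Within n σ (dom n 10 s₁.arr) := by
    intro v hv
    rw [mem_dom, all1 v hv]
    exact ⟨hv, one_ne_zero⟩
  have key : s₂.reg 15 = s.reg 15 ∧ s₂.reg 16 = s.reg 16 ∧ Within n σ (dom n 10 s₂.arr) ∧
      ∀ i < n, i < s.reg 3 → SingleAt (dom n 10 s₂.arr) (s.arr 7 i) := by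
    have := BProg.run_for (i := 13) (s := s₁) f1 (p := .ite (.nz (.sub (.reg 3) (.reg 13)))
      (.seq (.assign 6 (.arr 7 (.reg 13))) (.seq (.assign 4 (.arr 4 (.reg 13))) (fixP 6 4)))
      .skip) (by decide) (fun j t => t.reg 3 = s.reg 3 ∧ t.arr 4 = s.arr 4 ∧ t.arr 7 = s.arr 7 ∧
        Within n σ (dom n 10 t.arr) ∧
        ∀ i < j, i < s.reg 3 → SingleAt (dom n 10 t.arr) (s.arr 7 i))
      ⟨by simp [f3], by simp [f4], by simp [f7], w1, by simp⟩ ?_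
    · exact ⟨(BProg.run_reg (by decide) _).trans f15, (BProg.run_reg (by decide) _).trans f16,
        this.2.2.2.1, this.2.2.2.2⟩
    rintro j hj t ⟨t3, t4, t7, tw, ts⟩ tj t0
    refine ⟨?_, ?_, ?_, ?_⟩
    · rw [Store.setReg_reg, if_neg (by decide), BProg.run_reg (by decide), t3]
    · rw [Store.setReg_arr, BProg.run_arr (by decide), t4]
    · rw [Store.setReg_arr, BProg.run_arr (by decide), t7]
    · simp only [Store.setReg_arr]
      by_cases hjk : j < s.reg 3
      · rw [BProg.run, if_pos (by simp only [Formula.Holds, Expr.eval, t3, tj]; omega)]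
        simp only [BProg.run, Expr.eval]
        set t' := (t.setReg 6 (t.arr 7 (t.reg 13))).setReg 4
          ((t.setReg 6 (t.arr 7 (t.reg 13))).arr 4
            ((t.setReg 6 (t.arr 7 (t.reg 13))).reg 13)) with ht'
        have e6 : t'.reg 6 = s.arr 7 j := by simp [ht', t7, tj]
        have e4 : t'.reg 4 = s.arr 4 j := by simp [ht', t4, tj]
        have ed : dom n 10 t'.arr = dom n 10 t.arr := rfl
        refine ⟨within_fixP (by rwa [ed]) (by rw [e4, e6, hC j hjk]), fun i hi hi3 => ?_⟩
        refine singleAt_fixP ?_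
        rw [e6, ed]
        rcases Nat.lt_succ_iff_lt_or_eq.1 hi with hi | rfl
        · exact .inr (ts i hi hi3)
        · exact .inl rfl
      · rw [BProg.run, if_neg (by simp only [Formula.Holds, Expr.eval, t3, tj]; omega)]
        refine ⟨tw, fun i hi hi3 => ts i ?_ hi3⟩
        omega
  obtain ⟨k1, k2, k3, k4⟩ := key
  simp only [BProg.run, Expr.eval]
  set s₃ := (fixP 15 4).run (s₂.setReg 4 1) with hs₃
  have w3 : Within n σ (dom n 10 s₃.arr) := by
    refine within_fixP k3 ?_
    simp [k1, ha]
  have g15 : (s₂.setReg 4 1).reg 15 = s.reg 15 := by simp [k1]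
  have g16 : s₃.reg 16 = s.reg 16 := (BProg.run_reg (by decide) _).trans (by simp [k2])
  have e16 : (s₃.setReg 4 2).reg 16 = s.reg 16 := by simp [g16]
  refine ⟨within_fixP w3 ?_, fun v hv => singleAt_fixP ?_⟩
  · rw [e16, hb]
    simp
  · rw [e16]
    rcases hv with rfl | rfl | ⟨i, hi, rfl⟩
    · exact .inr (singleAt_fixP (.inl g15.symm))
    · exact .inl rfl
    · exact .inr (singleAt_fixP (.inr (k4 i (by omega) hi)))

/-- The label `c` and the label `-c` do not occur at adjacent vertices. -/
def noConflictF (c : Fin 3) : Formula :=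
  .neg (.ex 100 (.ex 101 (.conj (.nz (adjE 100 101)) (.conj (.nz (.arr (13 + c.val) (.reg 100)))
    (.nz (.arr (13 + (-c).val) (.reg 101)))))))

theorem holds_noConflictF {n : ℕ} {A : ℕ → ℕ → Prop} {s : Store}
    (hA : ∀ u v, A u v → u < n ∧ v < n) (hE : Env n A s.arr) (h0 : s.reg 0 = n) (c : Fin 3) :
    (noConflictF c).Holds s ↔
      ∀ u w, A u w → (u, c) ∈ dom n 13 s.arr → (w, -c) ∉ dom n 13 s.arr := by
  have hadj : ∀ u < n, ∀ w < n,
      ((adjE 100 101).eval ((s.setReg 100 u).setReg 101 w) ≠ 0 ↔ A u w) := by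
    intro u hu w hw
    have := Env.eval_adjE (s := (s.setReg 100 u).setReg 101 w) hE (x := 100) (y := 101)
      (by simpa using hu) (by simpa using hw)
    simpa using this
  simp only [noConflictF, Formula.Holds, Expr.eval, Store.setReg_reg, Store.setReg_arr, h0,
    mem_dom, not_exists, not_and]
  constructor
  · intro h u w hA' hu hw
    exact fun h2 => h u (hA _ _ hA').1 w (by simpa using (hA _ _ hA').2)
      ((hadj u (hA _ _ hA').1 w (hA _ _ hA').2).2 hA') (by simpa using hu.2) (by simpa using h2)
  · intro h u hu w hw ha h1 h2
    simp only [show ((0 : ℕ) = 100) = False by simp, if_false] at hw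
    exact h u w ((hadj u hu w hw).1 ha) ⟨hu, by simpa using h1⟩ hw (by simpa using h2)

/-- The allowed labels describe an independent cutset that separates the vertices in the registers
`15` and `16`. -/
def checkF : Formula :=
  .conj (.neg (emptyF 13)) (.conj (noConflictF 0) (.conj (noConflictF 1) (.conj (noConflictF 2)
    (.conj (zeroF (.arr 13 (.reg 15))) (.conj (zeroF (.arr 15 (.reg 15)))
      (.conj (zeroF (.arr 13 (.reg 16))) (zeroF (.arr 14 (.reg 16)))))))))

theorem holds_checkF {n : ℕ} {A : ℕ → ℕ → Prop} {s : Store}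
    (hA : ∀ u v, A u v → u < n ∧ v < n) (hE : Env n A s.arr) (h0 : s.reg 0 = n)
    (ha : s.reg 15 < n) (hb : s.reg 16 < n) :
    checkF.Holds s ↔ (∀ v < n, ∃ c, (v, c) ∈ dom n 13 s.arr) ∧
      (∀ u w, A u w → ∀ c, (u, c) ∈ dom n 13 s.arr → (w, -c) ∉ dom n 13 s.arr) ∧
      (s.reg 15, 0) ∉ dom n 13 s.arr ∧ (s.reg 15, 2) ∉ dom n 13 s.arr ∧
      (s.reg 16, 0) ∉ dom n 13 s.arr ∧ (s.reg 16, 1) ∉ dom n 13 s.arr := by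
  have hN : (∀ u w, A u w → ∀ c, (u, c) ∈ dom n 13 s.arr → (w, -c) ∉ dom n 13 s.arr) ↔
      (noConflictF 0).Holds s ∧ (noConflictF 1).Holds s ∧ (noConflictF 2).Holds s := by
    simp only [holds_noConflictF hA hE h0]
    constructor
    · exact fun h => ⟨fun u w hu => h u w hu 0, fun u w hu => h u w hu 1, fun u w hu => h u w hu 2⟩
    · rintro ⟨h1, h2, h3⟩ u w hu c
      fin_cases c
      · exact h1 u w hu
      · exact h2 u w hu
      · exact h3 u w hu
  have hM : ∀ v < n, ∀ c : Fin 3, (v, c) ∉ dom n 13 s.arr ↔ s.arr (13 + c.val) v = 0 := by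
    intro v hv c
    simp [mem_dom, hv]
  rw [hN, ← not_holds_emptyF h0, hM _ ha, hM _ ha, hM _ hb, hM _ hb]
  simp only [checkF, Formula.Holds, holds_zeroF, Expr.eval, and_assoc]
  simp

/-- Answer yes, and output the vertices at which the label `0` is allowed. -/
def outP : BProg :=
  .seq (.assign 1 (.lit 1)) (.forBelow 14 (.ite (.nz (.arr 13 (.reg 14)))
    (.write 1 (.reg 14) (.lit 1)) (.write 1 (.reg 14) (.lit 0))))

theorem outP_spec {n : ℕ} {s : Store} (h0 : s.reg 0 = n) :
    (outP.run s).reg 1 = 1 ∧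
      ∀ v < n, ((outP.run s).arr 1 v = 1 ↔ (v, (0 : Fin 3)) ∈ dom n 13 s.arr) := by
  constructor
  · simp only [outP, BProg.run_seq]
    rw [BProg.run_reg (by decide)]
    simp [BProg.run, Expr.eval]
  · have key : ∀ v < n, ((outP.run s).arr 1 v = 1 ↔ s.arr 13 v ≠ 0) := by
      simp only [outP, BProg.run_seq]
      refine (BProg.run_for (i := 14) (s := (BProg.assign 1 (.lit 1)).run s) (n := n)
        (p := .ite (.nz (.arr 13 (.reg 14))) (.write 1 (.reg 14) (.lit 1))
          (.write 1 (.reg 14) (.lit 0))) (by simp [BProg.run, h0]) (by decide) (fun j t =>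
        t.arr 13 = s.arr 13 ∧ ∀ v < j, (t.arr 1 v = 1 ↔ s.arr 13 v ≠ 0)) ⟨rfl, by simp⟩ ?_).2
      rintro j hj t ⟨t1, t2⟩ tj t0
      refine ⟨(BProg.run_arr (by decide) t).trans t1, fun v hv => ?_⟩
      have hjv : v < j → v ≠ j := fun h => h.ne
      have ht : (Formula.nz (.arr 13 (.reg 14))).Holds t ↔ s.arr 13 j ≠ 0 := by
        simp [Formula.Holds, Expr.eval, t1, tj]
      rcases Nat.lt_succ_iff_lt_or_eq.1 hv with hv | rfl
      · simp only [BProg.run, Store.setReg_arr]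
        split <;> simpa [Expr.eval, tj, hjv hv] using t2 v hv
      · simp only [BProg.run, Store.setReg_arr, ht]
        split <;> rename_i h
        · simpa [Expr.eval, tj] using h
        · simpa [Expr.eval, tj] using h
    intro v hv
    rw [key v hv, mem_dom]
    simp [hv]

/-- Look for an independent cutset that separates the vertices in the registers `15` and `16` and
agrees with the digits in array `4`. -/
def pairP : BProg :=
  .seq guessP (.seq acP (.seq (copyP 10 13) (.seq solveP (.ite checkF outP .skip))))

/-- A positive answer in register `1` comes with an independent cutset in array `1`. -/
def Sound {n : ℕ} (G : SimpleGraph (Fin n)) (s : Store) : Prop :=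
  s.reg 1 = 0 ∨ s.reg 1 = 1 ∧ IsIndependentCutset G (outputSet n s)

/-- The digits in array `4` are the labels that some proper labelling, with label `1` at `a` and
label `2` at `b`, gives to the vertices in array `7`. -/
def Guess (A : ℕ → ℕ → Prop) (n : ℕ) (a b : ℕ) (s : Store) : Prop :=
  ∃ σ : ℕ → Fin 3, Proper A σ ∧ a < n ∧ b < n ∧ σ a = 1 ∧ σ b = 2 ∧
    ∀ i < s.reg 3, s.arr 4 i = (σ (s.arr 7 i)).val

/-- What the second phase does not change, relative to its start `s`. -/
structure Keeps {n : ℕ} (G : SimpleGraph (Fin n)) (s t : Store) : Prop where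
  env : Env n (adjNat G) t.arr
  sound : Sound G t
  reg3 : t.reg 3 = s.reg 3
  arr7 : t.arr 7 = s.arr 7
  ans : s.reg 1 = 1 → t.reg 1 = 1

theorem Keeps.trans {n : ℕ} {G : SimpleGraph (Fin n)} {s t u : Store} (h : Keeps G s t)
    (h' : Keeps G t u) : Keeps G s u :=
  ⟨h'.env, h'.sound, h'.reg3.trans h.reg3, h'.arr7.trans h.arr7, fun e => h'.ans (h.ans e)⟩

theorem Keeps.setReg {n : ℕ} {G : SimpleGraph (Fin n)} {s t : Store} (h : Keeps G s t) {x v : ℕ}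
    (hx : 10 ≤ x) : Keeps G s (t.setReg x v) := by
  have h1 : (1 : ℕ) ≠ x := by omega
  have h3 : (3 : ℕ) ≠ x := by omega
  refine ⟨h.env, ?_, by simp [h3, h.reg3], h.arr7, by simpa [h1] using h.ans⟩
  have := h.sound
  simpa [Sound, h1, outputSet] using this

/-- The set of vertices in array `7` hits all triangles. -/
def HitSet (A : ℕ → ℕ → Prop) (s : Store) : Prop := Hits A {v | ∃ i < s.reg 3, v = s.arr 7 i}

open Classical in
/-- A positive answer is sound whatever the guess, since the final test is made on the domains
themselves. If the guess is right and the guessed vertices hit all triangles, the answer is yes. -/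
theorem pairP_spec {n : ℕ} {G : SimpleGraph (Fin n)} {s : Store} (hE : Env n (adjNat G) s.arr)
    (h0 : s.reg 0 = n) (ha : s.reg 15 < n) (hb : s.reg 16 < n) (hS : Sound G s) :
    Keeps G s (pairP.run s) ∧ ((∀ v < n, ∃ y z, Tri (adjNat G) v y z) → HitSet (adjNat G) s →
      s.reg 3 ≤ n → Guess (adjNat G) n (s.reg 15) (s.reg 16) s → (pairP.run s).reg 1 = 1) := by
  have hA := adjNat_lt G
  have hs := adjNat_symm G
  set s₁ := guessP.run s with hs₁
  set s₂ := acP.run s₁ with hs₂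
  set s₃ := (copyP 10 13).run s₂ with hs₃
  set s₄ := solveP.run s₃ with hs₄
  have hrun : pairP.run s = if checkF.Holds s₄ then outP.run s₄ else s₄ := by
    simp only [pairP, BProg.run]
    rfl
  have E1 : Env n (adjNat G) s₁.arr := hE.run (by decide)
  have E2 : Env n (adjNat G) s₂.arr := E1.run (by decide)
  have E3 : Env n (adjNat G) s₃.arr := E2.run (by decide)
  have E4 : Env n (adjNat G) s₄.arr := E3.run (by decide)
  have hreg : ∀ x, x ∉ solveP.regs → x ∉ (copyP 10 13).regs → x ∉ acP.regs → x ∉ guessP.regs →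
      s₄.reg x = s.reg x := by
    intro x h1 h2 h3 h4
    rw [hs₄, BProg.run_reg h1, hs₃, BProg.run_reg h2, hs₂, BProg.run_reg h3, hs₁,
      BProg.run_reg h4]
  have hr1 : s₁.reg 0 = n := (BProg.run_reg (by decide) _).trans h0
  have hr2 : s₂.reg 0 = n := (BProg.run_reg (by decide) _).trans hr1
  have hr3 : s₃.reg 0 = n := (BProg.run_reg (by decide) _).trans hr2
  have hr4 : s₄.reg 0 = n := (BProg.run_reg (by decide) _).trans hr3
  have ha1 : s₄.reg 1 = s.reg 1 := hreg 1 (by decide) (by decide) (by decide) (by decide)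
  have hr15 : s₄.reg 15 = s.reg 15 := hreg 15 (by decide) (by decide) (by decide) (by decide)
  have hr16 : s₄.reg 16 = s.reg 16 := hreg 16 (by decide) (by decide) (by decide) (by decide)
  have harr : s₄.arr 1 = s.arr 1 := by
    rw [hs₄, BProg.run_arr (by decide), hs₃, BProg.run_arr (by decide), hs₂,
      BProg.run_arr (by decide), hs₁, BProg.run_arr (by decide)]
  have hcheck := holds_checkF hA E4 hr4 (by rwa [hr15]) (by rwa [hr16])
  constructor
  · refine ⟨hE.run (by decide), ?_, BProg.run_reg (by decide) s, BProg.run_arr (by decide) s, ?_⟩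
    · rw [hrun]
      split
      · rename_i h
        obtain ⟨o1, o2⟩ := outP_spec hr4
        refine .inr ⟨o1, ?_⟩
        have hset : outputSet n (outP.run s₄) =
            {v : Fin n | (v.val, (0 : Fin 3)) ∈ dom n 13 s₄.arr} := by
          ext v
          exact o2 v v.2
        obtain ⟨c1, c2, c3, c4, c5, c6⟩ := hcheck.1 h
        rw [hset]
        exact isIndependentCutset_of_labels (by rwa [hr15]) (by rwa [hr16]) c1 c2 c3 c4 c5 c6
      · have : outputSet n s₄ = outputSet n s := by simp [outputSet, harr]
        rw [Sound, ha1, this]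
        exact hS
    · intro h
      rw [hrun]
      split
      · exact (outP_spec hr4).1
      · rw [ha1, h]
  · rintro hT hH h3 ⟨σ, hσ, -, -, σa, σb, hC⟩
    obtain ⟨g1, g2⟩ := guessP_spec h0 h3 hC σa σb
    rw [← hs₁] at g1 g2
    obtain ⟨a1, a2, a3⟩ := acP_spec hA E1 hr1
    rw [← hs₂] at a1 a2 a3
    have w2 := a3 σ hσ g1
    -- A vertex has a single label if it was guessed; otherwise it has a guessed neighbour, since it
    -- lies in a triangle, and cannot have the label that conflicts with that of the neighbour.
    have htwo : TwoValued n (dom n 10 s₂.arr) := by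
      have hval : ∀ v, (∃ i < s.reg 3, v = s.arr 7 i) → SingleAt (dom n 10 s₂.arr) v :=
        fun v hv => (g2 v (.inr (.inr hv))).mono a1
      have hnb : ∀ v w, adjNat G v w → (∃ i < s.reg 3, w = s.arr 7 i) →
          ∃ c, (v, c) ∉ dom n 10 s₂.arr := by
        intro v w hvw hw
        refine ⟨-σ w, fun hc => a2 v _ hc ⟨w, hvw, fun c' hc' => ?_⟩⟩
        rw [neg_neg]
        exact hval w hw c' (σ w) hc' (w2 w (hA _ _ hvw).2)
      intro v hv
      obtain ⟨y, z, ht⟩ := hT v hv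
      rcases hH v y z ht with h | h | h
      · by_contra hc
        push Not at hc
        exact absurd (hval v h 0 1 (hc 0) (hc 1)) (by decide)
      · exact hnb v y ht.1 h
      · exact hnb v z ht.2.2 h
    have d3 : dom n 13 s₃.arr = dom n 10 s₂.arr := dom_copyP hr2 (by omega)
    obtain ⟨v1, ⟨-, v2, τ, -, hτ⟩, v3⟩ := solveP_spec hA hs E3 hr3
      (by rw [d3]; exact ⟨htwo, a2, σ, hσ, w2⟩)
    rw [← hs₄] at v1 v2 v3 hτ
    rw [d3] at v1
    have hsub := v1.trans a1
    rw [hrun, if_pos]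
    · exact (outP_spec hr4).1
    · rw [hcheck, hr15, hr16]
      have hx : ∀ x, x = s.reg 15 ∨ x = s.reg 16 → x < n → ∀ c, c ≠ σ x →
          (x, c) ∉ dom n 13 s₄.arr := by
        intro x hx hxn c hc hm
        refine hc (g2 x (hx.imp id .inl) c (σ x) (hsub hm) (g1 x hxn))
      refine ⟨fun v hv => ⟨τ v, hτ v hv⟩, ?_, ?_, ?_, ?_, ?_⟩
      · intro u w huw c hu hw
        exact v2 u c hu ⟨w, huw, fun c' hc' => v3 w (hA _ _ huw).2 c' (-c) hc' hw⟩
      · exact hx _ (.inl rfl) ha 0 (by rw [σa]; decide)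
      · exact hx _ (.inl rfl) ha 2 (by rw [σa]; decide)
      · exact hx _ (.inr rfl) hb 0 (by rw [σb]; decide)
      · exact hx _ (.inr rfl) hb 1 (by rw [σb]; decide)

/-- Look for an independent cutset that agrees with the digits in array `4`. -/
def pairsP : BProg := .forBelow 15 (.forBelow 16 pairP)

theorem pairsP_spec {n : ℕ} {G : SimpleGraph (Fin n)} {s : Store} (hE : Env n (adjNat G) s.arr)
    (h0 : s.reg 0 = n) (hS : Sound G s) :
    Keeps G s (pairsP.run s) ∧ ((∀ v < n, ∃ y z, Tri (adjNat G) v y z) → HitSet (adjNat G) s →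
      s.reg 3 ≤ n → (∃ a b, Guess (adjNat G) n a b s) → (pairsP.run s).reg 1 = 1) := by
  have hk : Keeps G s s := ⟨hE, hS, rfl, rfl, id⟩
  have key : Keeps G s (pairsP.run s) ∧ (pairsP.run s).arr 4 = s.arr 4 ∧
      ∀ a < n, ∀ b < n, ((∀ v < n, ∃ y z, Tri (adjNat G) v y z) → HitSet (adjNat G) s →
      s.reg 3 ≤ n → Guess (adjNat G) n a b s → (pairsP.run s).reg 1 = 1) := by
    refine BProg.run_for (i := 15) h0 (by decide) (fun j t => Keeps G s t ∧ t.arr 4 = s.arr 4 ∧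
      ∀ a < j, ∀ b < n, ((∀ v < n, ∃ y z, Tri (adjNat G) v y z) → HitSet (adjNat G) s →
      s.reg 3 ≤ n → Guess (adjNat G) n a b s → t.reg 1 = 1))
      ⟨hk.setReg (by norm_num), rfl, by simp⟩ ?_
    rintro a ha t ⟨tk, t4, tg⟩ ta t0
    have inner := BProg.run_for (i := 16) (p := pairP) t0 (by decide) (fun j u => Keeps G t u ∧
      u.arr 4 = s.arr 4 ∧ u.reg 15 = a ∧
      ∀ b < j, ((∀ v < n, ∃ y z, Tri (adjNat G) v y z) → HitSet (adjNat G) s →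
      s.reg 3 ≤ n → Guess (adjNat G) n a b s → u.reg 1 = 1))
      ⟨Keeps.setReg ⟨tk.env, tk.sound, rfl, rfl, id⟩ (by norm_num), t4, by simp [ta], by simp⟩ ?_
    · obtain ⟨i1, i2, i3, i4⟩ := inner
      refine ⟨(tk.trans i1).setReg (by norm_num), i2, fun a' ha' b hb h1 h2 h3 h4 => ?_⟩
      rw [Store.setReg_reg, if_neg (by decide)]
      rcases Nat.lt_succ_iff_lt_or_eq.1 ha' with ha' | rfl
      · exact i1.ans (tg a' ha' b hb h1 h2 h3 h4)
      · exact i4 b hb h1 h2 h3 h4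
    · rintro b hb u ⟨uk, u4, u15, ug⟩ ub u0
      obtain ⟨p1, p2⟩ := pairP_spec uk.env u0 (by rwa [u15]) (by rwa [ub]) uk.sound
      refine ⟨(uk.trans p1).setReg (by norm_num), ?_, ?_, fun b' hb' h1 h2 h3 h4 => ?_⟩
      · exact (BProg.run_arr (by decide) u).trans u4
      · rw [Store.setReg_reg, if_neg (by decide), BProg.run_reg (by decide), u15]
      · rw [Store.setReg_reg, if_neg (by decide)]
        have e3 : u.reg 3 = s.reg 3 := uk.reg3.trans tk.reg3
        have e7 : u.arr 7 = s.arr 7 := uk.arr7.trans tk.arr7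
        rcases Nat.lt_succ_iff_lt_or_eq.1 hb' with hb' | rfl
        · exact p1.ans (ug b' hb' h1 h2 h3 h4)
        · refine p2 h1 ?_ (by rwa [e3]) ?_
          · rw [HitSet, e3, e7]
            exact h2
          · rw [u15, ub, Guess, e3, e7, u4]
            exact h4
  refine ⟨key.1, ?_⟩
  rintro h1 h2 h3 ⟨a, b, h4⟩
  have h4' := h4
  obtain ⟨σ, -, ha, hb, -⟩ := h4'
  exact key.2.2 a ha b hb h1 h2 h3 h4

/-! ### Digits, and hitting the triangles -/

/-- Write the ternary digits of register `2` into array `4`, from the highest digit down, by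
subtracting powers of `3`. -/
def decodeP : BProg :=
  .seq (.assign 4 (.reg 2)) (.forBelow 17 (.seq
    (.assign 6 (.sub (.sub (.reg 0) (.lit 1)) (.reg 17))) (.seq
    (.assign 7 (.arr 3 (.reg 6)))
    (.ite (.nz (.sub (.add (.reg 4) (.lit 1)) (.reg 7)))
      (.seq (.assign 4 (.sub (.reg 4) (.reg 7)))
        (.ite (.nz (.sub (.add (.reg 4) (.lit 1)) (.reg 7)))
          (.seq (.assign 4 (.sub (.reg 4) (.reg 7))) (.write 4 (.reg 6) (.lit 2)))
          (.write 4 (.reg 6) (.lit 1))))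
      (.write 4 (.reg 6) (.lit 0))))))

/-- The digit of `m` at `q = 3 ^ i` and the lower part of `m`, obtained from the part `r` of `m`
below `3 * q` by at most two subtractions. -/
theorem digit_step {m q r : ℕ} (hq : 0 < q) (hr : r = m % (q * 3)) :
    (r < q → m / q % 3 = 0 ∧ m % q = r) ∧
    (q ≤ r → r - q < q → m / q % 3 = 1 ∧ m % q = r - q) ∧
    (q ≤ r → q ≤ r - q → m / q % 3 = 2 ∧ m % q = r - q - q) := by
  have h1 : m / q % 3 = r / q := by rw [hr, Nat.mod_mul_right_div_self]
  have h2 : m % q = r % q := by rw [hr, Nat.mod_mul_right_mod]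
  have h3 : r < q * 3 := hr ▸ Nat.mod_lt _ (by omega)
  rw [h1, h2]
  refine ⟨fun h => ⟨Nat.div_eq_of_lt h, Nat.mod_eq_of_lt h⟩, fun h h' => ⟨?_, ?_⟩,
    fun h h' => ⟨?_, ?_⟩⟩
  · exact Nat.div_eq_of_lt_le (by omega) (by omega)
  · rw [Nat.mod_eq_sub_mod h, Nat.mod_eq_of_lt h']
  · exact Nat.div_eq_of_lt_le (by omega) (by omega)
  · rw [Nat.mod_eq_sub_mod h, Nat.mod_eq_sub_mod h', Nat.mod_eq_of_lt (by omega)]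

theorem decodeP_spec {n : ℕ} {A : ℕ → ℕ → Prop} {s : Store} (hE : Env n A s.arr)
    (h0 : s.reg 0 = n) (hm : s.reg 2 < 3 ^ n) :
    ∀ i < n, (decodeP.run s).arr 4 i = s.reg 2 / 3 ^ i % 3 := by
  simp only [decodeP, BProg.run_seq]
  set s₁ := (BProg.assign 4 (.reg 2)).run s with hs₁
  have := BProg.run_for (i := 17) (s := s₁) (n := n) (by simp [hs₁, BProg.run, h0])
    (p := (.seq
    (.assign 6 (.sub (.sub (.reg 0) (.lit 1)) (.reg 17))) (.seq
    (.assign 7 (.arr 3 (.reg 6)))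
    (.ite (.nz (.sub (.add (.reg 4) (.lit 1)) (.reg 7)))
      (.seq (.assign 4 (.sub (.reg 4) (.reg 7)))
        (.ite (.nz (.sub (.add (.reg 4) (.lit 1)) (.reg 7)))
          (.seq (.assign 4 (.sub (.reg 4) (.reg 7))) (.write 4 (.reg 6) (.lit 2)))
          (.write 4 (.reg 6) (.lit 1))))
      (.write 4 (.reg 6) (.lit 0)))))) (by decide)
    (fun j t => t.arr 3 = s.arr 3 ∧ t.reg 4 = s.reg 2 % 3 ^ (n - j) ∧
      ∀ i < n, n - j ≤ i → t.arr 4 i = s.reg 2 / 3 ^ i % 3) ?_ ?_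
  · exact fun i hi => this.2.2 i hi (by omega)
  · refine ⟨rfl, ?_, fun i hi hi' => by omega⟩
    simp [hs₁, BProg.run, Expr.eval, Nat.mod_eq_of_lt hm]
  · rintro j hj t ⟨t3, t4, td⟩ tj t0
    refine ⟨(BProg.run_arr (by decide) t).trans t3, ?_⟩
    obtain ⟨i, hi⟩ : ∃ i, n - j = i + 1 := ⟨n - j - 1, by omega⟩
    have hi1 : n - 1 - j = i := by omega
    have hi2 : n - (j + 1) = i := by omega
    rw [hi, pow_succ] at t4
    obtain ⟨c0, c1, c2⟩ := digit_step (by positivity) t4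
    have hp : t.arr 3 i = 3 ^ i := by rw [t3, hE.pow i (by omega)]
    rw [hi2]
    have hrest : ∀ i' < n, i ≤ i' → i' ≠ i → t.arr 4 i' = s.reg 2 / 3 ^ i' % 3 :=
      fun i' h1 h2 h3 => td i' h1 (by omega)
    simp only [BProg.run, Formula.Holds, Expr.eval, Store.setReg_reg, Store.setReg_arr, t0, tj, hi1,
      hp, ne_eq, if_true, Nat.reduceEqDiff, if_false]
    by_cases h1 : t.reg 4 < 3 ^ i
    · obtain ⟨e1, e2⟩ := c0 h1
      rw [if_neg (by omega)]
      refine ⟨by simp [e2], fun i' h1 h2 => ?_⟩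
      by_cases h3 : i' = i
      · subst h3
        simp [e1]
      · simpa [h3] using hrest i' h1 h2 h3
    · rw [if_pos (by omega)]
      by_cases h2 : t.reg 4 - 3 ^ i < 3 ^ i
      · obtain ⟨e1, e2⟩ := c1 (by omega) h2
        rw [if_neg (by omega)]
        refine ⟨by simp [e2], fun i' h1 h2 => ?_⟩
        by_cases h3 : i' = i
        · subst h3
          simp [e1]
        · simpa [h3] using hrest i' h1 h2 h3
      · obtain ⟨e1, e2⟩ := c2 (by omega) (by omega)
        rw [if_pos (by omega)]
        refine ⟨by simp [e2], fun i' h1 h2 => ?_⟩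
        by_cases h3 : i' = i
        · subst h3
          simp [e1]
        · simpa [h3] using hrest i' h1 h2 h3

/-- The formula that says that three registers hold a triangle. -/
def triF (x y z : ℕ) : Formula :=
  .conj (.nz (adjE x y)) (.conj (.nz (adjE y z)) (.nz (adjE x z)))

theorem holds_triF {n : ℕ} {A : ℕ → ℕ → Prop} {s : Store} (hE : Env n A s.arr) {x y z : ℕ}
    (hx : s.reg x < n) (hy : s.reg y < n) (hz : s.reg z < n) :
    (triF x y z).Holds s ↔ Tri A (s.reg x) (s.reg y) (s.reg z) := by
  simp only [triF, Formula.Holds, Tri, hE.eval_adjE hx hy, hE.eval_adjE hy hz, hE.eval_adjE hx hz]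

/-- The program for `hitStep`: the vertices are in the registers `18`, `19`, `20`; array `6` holds
the list, register `5` its length, and array `5` marks its members. -/
def hitStepP : BProg :=
  .ite (.conj (triF 18 19 20) (.conj (zeroF (.arr 5 (.reg 18)))
      (.conj (zeroF (.arr 5 (.reg 19))) (zeroF (.arr 5 (.reg 20))))))
    (.seq (.ite (zeroF (.arr 4 (.reg 5))) (.assign 6 (.reg 18))
        (.ite (.nz (eqE (.arr 4 (.reg 5)) (.lit 1))) (.assign 6 (.reg 19)) (.assign 6 (.reg 20))))
      (.seq (.write 5 (.reg 6) (.lit 1)) (.seq (.write 6 (.reg 5) (.reg 6))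
        (.assign 5 (.add (.reg 5) (.lit 1))))))
    .skip

/-- The memory represents the list `L` of vertices. -/
structure Rep (n : ℕ) (L : List ℕ) (s : Store) : Prop where
  len : s.reg 5 = L.length
  list : ∀ i < L.length, L[i]? = some (s.arr 6 i)
  mark : ∀ v < n, (s.arr 5 v ≠ 0 ↔ v ∈ L)

theorem Rep.setReg {n : ℕ} {L : List ℕ} {s : Store} (h : Rep n L s) {x v : ℕ} (hx : 10 ≤ x) :
    Rep n L (s.setReg x v) := by
  have : (5 : ℕ) ≠ x := by omega
  exact ⟨by simp [this, h.len], h.list, h.mark⟩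

theorem rep_hitStepP {n : ℕ} {A : ℕ → ℕ → Prop} {s : Store} (hE : Env n A s.arr) {L : List ℕ}
    (h : Rep n L s) (hx : s.reg 18 < n) (hy : s.reg 19 < n) (hz : s.reg 20 < n) :
    Rep n (hitStep A (s.arr 4) L (s.reg 18, s.reg 19, s.reg 20)) (hitStepP.run s) := by
  have hm : ∀ v < n, (s.arr 5 v = 0 ↔ v ∉ L) := fun v hv => by rw [← h.mark v hv, not_not]
  have hF : Formula.Holds (.conj (triF 18 19 20) (.conj (zeroF (.arr 5 (.reg 18)))
      (.conj (zeroF (.arr 5 (.reg 19))) (zeroF (.arr 5 (.reg 20)))))) s ↔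
      Tri A (s.reg 18) (s.reg 19) (s.reg 20) ∧ s.reg 18 ∉ L ∧ s.reg 19 ∉ L ∧ s.reg 20 ∉ L := by
    rw [← hm _ hx, ← hm _ hy, ← hm _ hz, ← holds_triF hE hx hy hz]
    simp [Formula.Holds, Expr.eval]
  by_cases hc : Tri A (s.reg 18) (s.reg 19) (s.reg 20) ∧ s.reg 18 ∉ L ∧ s.reg 19 ∉ L ∧
      s.reg 20 ∉ L
  · rw [hitStepP, BProg.run, if_pos (hF.2 hc), hitStep, if_pos hc]
    have hpick : BProg.run (.ite (zeroF (.arr 4 (.reg 5))) (.assign 6 (.reg 18))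
        (.ite (.nz (eqE (.arr 4 (.reg 5)) (.lit 1))) (.assign 6 (.reg 19))
          (.assign 6 (.reg 20)))) s =
        s.setReg 6 (pick (s.arr 4 L.length) (s.reg 18) (s.reg 19) (s.reg 20)) := by
      simp only [BProg.run, holds_zeroF, Formula.Holds, Expr.eval, eval_eqE, h.len, pick]
      split_ifs <;> simp_all
    simp only [BProg.run_seq]
    rw [hpick]
    simp only [BProg.run, Expr.eval]
    set t := pick (s.arr 4 L.length) (s.reg 18) (s.reg 19) (s.reg 20) with ht
    refine ⟨?_, ?_, ?_⟩
    · simp [h.len]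
    · intro i hi
      rw [List.length_append, List.length_singleton] at hi
      rcases Nat.lt_succ_iff_lt_or_eq.1 hi with hi | rfl
      · rw [List.getElem?_append_left hi, h.list i hi]
        simp [h.len, hi.ne]
      · simp [h.len]
    · intro v hv
      have := h.mark v hv
      by_cases e : v = t
      · simp [e]
      · simpa [e] using this
  · rw [hitStepP, BProg.run, if_neg (fun h' => hc (hF.1 h')), hitStep, if_neg hc]
    exact h

/-- The program for `hitList`. -/
def hitP : BProg :=
  .seq (.assign 5 (.lit 0)) (.seq (.forBelow 13 (.write 5 (.reg 13) (.lit 0)))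
    (.forBelow 18 (.forBelow 19 (.forBelow 20 hitStepP))))

theorem rep_hitP {n : ℕ} {A : ℕ → ℕ → Prop} {s : Store} (hE : Env n A s.arr)
    (h0 : s.reg 0 = n) : Rep n (hitList A n (s.arr 4)) (hitP.run s) := by
  simp only [hitP, BProg.run_seq]
  set s₁ := (BProg.assign 5 (.lit 0)).run s with hs₁
  set s₂ := (BProg.forBelow 13 (.write 5 (.reg 13) (.lit 0))).run s₁ with hs₂
  have r1 : s₁.reg 0 = n := by simp [hs₁, BProg.run, h0]
  have r2 : s₂.reg 0 = n := (BProg.run_reg (by decide) _).trans r1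
  have hrep : Rep n [] s₂ := by
    refine ⟨?_, by simp, ?_⟩
    · rw [hs₂, BProg.run_reg (by decide)]
      simp [hs₁, BProg.run, Expr.eval]
    · have : ∀ v < n, s₂.arr 5 v = 0 := by
        refine BProg.run_for (i := 13) r1 (by decide) (fun j t => ∀ v < j, t.arr 5 v = 0)
          (by simp) ?_
        intro j hj t ht tj t0 v hv
        rcases Nat.lt_succ_iff_lt_or_eq.1 hv with hv | rfl
        · simp [BProg.run, Expr.eval, ht v hv]
        · simp [BProg.run, Expr.eval, tj]
      intro v hv
      simp [this v hv]
  have E2 : Env n A s₂.arr := Env.run (s := s₁) hE (by decide)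
  have a4 : s₂.arr 4 = s.arr 4 := BProg.run_arr (by decide) s₁
  refine (BProg.run_for (i := 18) r2 (by decide) (fun j t => Env n A t.arr ∧ t.arr 4 = s.arr 4 ∧
    Rep n ((List.range j).foldl (fun L x => (List.range n).foldl (fun L y =>
    (List.range n).foldl (fun L z => hitStep A (s.arr 4) L (x, y, z)) L) L) []) t)
    ⟨E2, a4, hrep.setReg (by norm_num)⟩ ?_).2.2
  rintro x hx t ⟨tE, t4, tR⟩ tx t0
  rw [List.range_succ, List.foldl_append]
  generalize (List.range x).foldl (fun L x => (List.range n).foldl (fun L y =>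
    (List.range n).foldl (fun L z => hitStep A (s.arr 4) L (x, y, z)) L) L) [] = L₁ at tR ⊢
  simp only [List.foldl_cons, List.foldl_nil]
  refine ⟨tE.run (by decide), (BProg.run_arr (by decide) _).trans t4, Rep.setReg ?_ (by norm_num)⟩
  refine (BProg.run_for (i := 19) t0 (by decide) (fun j u => Env n A u.arr ∧ u.arr 4 = s.arr 4 ∧
    u.reg 18 = x ∧ Rep n ((List.range j).foldl (fun L y =>
    (List.range n).foldl (fun L z => hitStep A (s.arr 4) L (x, y, z)) L) L₁) u)
    ⟨tE, t4, by simp [tx], tR.setReg (by norm_num)⟩ ?_).2.2.2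
  rintro y hy u ⟨uE, u4, ux, uR⟩ uy u0
  rw [List.range_succ, List.foldl_append]
  generalize (List.range y).foldl (fun L y =>
    (List.range n).foldl (fun L z => hitStep A (s.arr 4) L (x, y, z)) L) L₁ = L₂ at uR ⊢
  simp only [List.foldl_cons, List.foldl_nil]
  refine ⟨uE.run (by decide), (BProg.run_arr (by decide) _).trans u4,
    by rw [Store.setReg_reg, if_neg (by decide), BProg.run_reg (by decide), ux],
    Rep.setReg ?_ (by norm_num)⟩
  refine (BProg.run_for (i := 20) u0 (by decide) (fun j w => Env n A w.arr ∧ w.arr 4 = s.arr 4 ∧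
    w.reg 18 = x ∧ w.reg 19 = y ∧ Rep n ((List.range j).foldl
    (fun L z => hitStep A (s.arr 4) L (x, y, z)) L₂) w)
    ⟨uE, u4, by simp [ux], by simp [uy], uR.setReg (by norm_num)⟩ ?_).2.2.2.2
  rintro z hz w ⟨wE, w4, wx, wy, wR⟩ wz w0
  rw [List.range_succ, List.foldl_append]
  simp only [List.foldl_cons, List.foldl_nil]
  refine ⟨wE.run (by decide), (BProg.run_arr (by decide) _).trans w4,
    by rw [Store.setReg_reg, if_neg (by decide), BProg.run_reg (by decide), wx],
    by rw [Store.setReg_reg, if_neg (by decide), BProg.run_reg (by decide), wy],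
    Rep.setReg ?_ (by norm_num)⟩
  have := rep_hitStepP wE wR (by rwa [wx]) (by rwa [wy]) (by rwa [wz])
  rwa [wx, wy, wz, w4] at this

/-! ### The phases of the algorithm -/

/-- Compute the offsets `i * n` in array `2` and the powers of `3` in array `3`. -/
def setupP : BProg :=
  .seq (.write 3 (.lit 0) (.lit 1)) (.forBelow 13 (.seq
    (.write 2 (.add (.reg 13) (.lit 1)) (.add (.arr 2 (.reg 13)) (.reg 0)))
    (.write 3 (.add (.reg 13) (.lit 1))
      (.add (.arr 3 (.reg 13)) (.add (.arr 3 (.reg 13)) (.arr 3 (.reg 13)))))))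

theorem env_setupP {n : ℕ} (G : SimpleGraph (Fin n)) :
    Env n (adjNat G) (setupP.run (inputStore G)).arr := by
  have h : ∀ i ≤ n, (setupP.run (inputStore G)).arr 2 i = i * n ∧
      (setupP.run (inputStore G)).arr 3 i = 3 ^ i := by
    simp only [setupP, BProg.run_seq]
    refine BProg.run_for (i := 13) (s := (BProg.write 3 (.lit 0) (.lit 1)).run (inputStore G))
      (n := n) (p := (.seq (.write 2 (.add (.reg 13) (.lit 1)) (.add (.arr 2 (.reg 13)) (.reg 0)))
        (.write 3 (.add (.reg 13) (.lit 1))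
          (.add (.arr 3 (.reg 13)) (.add (.arr 3 (.reg 13)) (.arr 3 (.reg 13)))))))
      (by simp [BProg.run, inputStore]) (by decide)
      (fun j t => ∀ i ≤ j, t.arr 2 i = i * n ∧ t.arr 3 i = 3 ^ i) ?_ ?_
    · intro i hi
      obtain rfl : i = 0 := by omega
      simp [BProg.run, Expr.eval, inputStore]
    · intro j hj t ht tj t0 i hi
      rcases Nat.lt_succ_iff_lt_or_eq.1 (Nat.lt_succ_of_le hi) with hi | rfl
      · have hne : i ≠ j + 1 := by omega
        simpa [BProg.run, Expr.eval, tj, hne] using ht i (by omega)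
      · obtain ⟨h1, h2⟩ := ht j le_rfl
        refine ⟨?_, ?_⟩
        · simp [BProg.run, Expr.eval, tj, t0, h1]
          ring
        · simp [BProg.run, Expr.eval, tj, h2]
          ring
  have h0 : (setupP.run (inputStore G)).arr 0 = (inputStore G).arr 0 :=
    BProg.run_arr (by decide) _
  refine ⟨fun i hi j hj => ?_, fun i hi => (h i hi).2⟩
  rw [h0, (h i hi.le).1]
  simp only [inputStore, true_and, ne_eq, ite_eq_right_iff, one_ne_zero, imp_false, not_not]
  constructor
  · rintro ⟨i', j', he, hadj⟩
    have h1 : i = i'.val := by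
      have h2 : j + n * i = j'.val + n * i'.val := by
        rw [mul_comm n, mul_comm n]
        omega
      have h1 : (j + n * i) / n = (j'.val + n * i'.val) / n := by rw [h2]
      rw [Nat.add_mul_div_left _ _ (by omega), Nat.add_mul_div_left _ _ (by omega),
        Nat.div_eq_of_lt hj, Nat.div_eq_of_lt j'.2] at h1
      omega
    subst h1
    obtain rfl : j = j'.val := by omega
    exact adjNat_val.2 hadj
  · rintro ⟨_, _, hadj⟩
    exact ⟨⟨i, hi⟩, ⟨j, hj⟩, rfl, hadj⟩

/-- Answer yes, and output the neighbourhood of the vertex in register `10`. -/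
def outNeighborsP : BProg :=
  .seq (.assign 1 (.lit 1)) (.forBelow 14 (.ite (.nz (adjE 10 14))
    (.write 1 (.reg 14) (.lit 1)) (.write 1 (.reg 14) (.lit 0))))

theorem outNeighborsP_spec {n : ℕ} {A : ℕ → ℕ → Prop} {s : Store} (hE : Env n A s.arr)
    (h0 : s.reg 0 = n) (hv : s.reg 10 < n) :
    (outNeighborsP.run s).reg 1 = 1 ∧
      ∀ u < n, ((outNeighborsP.run s).arr 1 u = 1 ↔ A (s.reg 10) u) := by
  constructor
  · simp only [outNeighborsP, BProg.run_seq]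
    rw [BProg.run_reg (by decide)]
    simp [BProg.run, Expr.eval]
  · simp only [outNeighborsP, BProg.run_seq]
    refine (BProg.run_for (i := 14) (s := (BProg.assign 1 (.lit 1)).run s) (n := n)
      (p := .ite (.nz (adjE 10 14)) (.write 1 (.reg 14) (.lit 1)) (.write 1 (.reg 14) (.lit 0)))
      (by simp [BProg.run, h0]) (by decide) (fun j t => Env n A t.arr ∧ t.reg 10 = s.reg 10 ∧
        ∀ u < j, (t.arr 1 u = 1 ↔ A (s.reg 10) u)) ⟨hE, by simp [BProg.run], by simp⟩ ?_).2.2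
    rintro j hj t ⟨tE, t10, t1⟩ tj t0
    refine ⟨tE.run (by decide), ?_, fun u hu => ?_⟩
    · rw [Store.setReg_reg, if_neg (by decide), BProg.run_reg (by decide), t10]
    · have ht : (Formula.nz (adjE 10 14)).Holds t ↔ A (s.reg 10) j := by
        have := tE.eval_adjE (x := 10) (y := 14) (by rwa [t10]) (by rwa [tj])
        rw [t10, tj] at this
        exact this
      have hju : u < j → u ≠ j := fun h => h.ne
      rcases Nat.lt_succ_iff_lt_or_eq.1 hu with hu | rfl
      · simp only [BProg.run, Store.setReg_arr]
        split <;> simpa [Expr.eval, tj, hju hu] using t1 u hu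
      · simp only [BProg.run, Store.setReg_arr]
        split <;> rename_i h
        · simpa [Expr.eval, tj] using ht.1 h
        · simpa [Expr.eval, tj] using fun h' => h (ht.2 h')

/-- Every vertex that is not adjacent to all others lies in a triangle, so that its neighbourhood is
not independent. -/
def NoNeighborhood (A : ℕ → ℕ → Prop) (n : ℕ) : Prop :=
  ∀ v < n, (∃ u < n, u ≠ v ∧ ¬ A v u) → ∃ y z, Tri A v y z

/-- Look for a neighbourhood that is an independent cutset. -/
def neighborhoodsP : BProg :=
  .forBelow 10 (.ite (.conj
    (.ex 100 (.conj (zeroF (eqE (.reg 100) (.reg 10))) (zeroF (adjE 10 100))))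
    (.neg (.ex 100 (.ex 101 (triF 10 100 101))))) outNeighborsP .skip)

theorem neighborhoodsP_spec {n : ℕ} {G : SimpleGraph (Fin n)} {s : Store}
    (hE : Env n (adjNat G) s.arr) (h0 : s.reg 0 = n) (hS : Sound G s) :
    Sound G (neighborhoodsP.run s) ∧
      ((neighborhoodsP.run s).reg 1 = 1 ∨ NoNeighborhood (adjNat G) n) := by
  have hA := adjNat_lt G
  have key : Sound G (neighborhoodsP.run s) ∧ Env n (adjNat G) (neighborhoodsP.run s).arr ∧
      ((neighborhoodsP.run s).reg 1 = 1 ∨ ∀ v < n, (∃ u < n, u ≠ v ∧ ¬ adjNat G v u) →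
        ∃ y z, Tri (adjNat G) v y z) := by
    refine BProg.run_for (i := 10) h0 (by decide) (fun j t => Sound G t ∧
      Env n (adjNat G) t.arr ∧ (t.reg 1 = 1 ∨ ∀ v < j, (∃ u < n, u ≠ v ∧ ¬ adjNat G v u) →
        ∃ y z, Tri (adjNat G) v y z)) ⟨by simpa [Sound, outputSet] using hS, hE, by simp⟩ ?_
    rintro v hv t ⟨tS, tE, t1⟩ tv t0
    have hF : Formula.Holds (.conj (.ex 100 (.conj (zeroF (eqE (.reg 100) (.reg 10)))
        (zeroF (adjE 10 100)))) (.neg (.ex 100 (.ex 101 (triF 10 100 101))))) t ↔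
        (∃ u < n, u ≠ v ∧ ¬ adjNat G v u) ∧ ¬ ∃ y z, Tri (adjNat G) v y z := by
      simp only [Formula.Holds, holds_zeroF, eval_eqE, Expr.eval, t0]
      refine and_congr (exists_congr fun u => and_congr_right fun hu => and_congr ?_ ?_)
        (not_congr ⟨?_, ?_⟩)
      · simp [tv]
      · have := Env.eval_adjE (s := t.setReg 100 u) tE (x := 10) (y := 100)
          (by simpa [tv] using hv) (by simpa using hu)
        simp only [Store.setReg_reg, tv] at this
        rw [show (v : ℕ) = (if (10 : ℕ) = 100 then u else v) by simp]
        rw [← not_iff_not, not_not]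
        simpa using this
      · rintro ⟨y, hy, z, hz, h⟩
        have hz : z < n := by simpa [t0] using hz
        rw [holds_triF (s := (t.setReg 100 y).setReg 101 z) tE (by simpa [tv] using hv)
          (by simpa using hy) (by simpa using hz)] at h
        exact ⟨y, z, by simpa [tv] using h⟩
      · rintro ⟨y, z, h⟩
        have hy := (hA _ _ h.1).2
        have hz := (hA _ _ h.2.2).2
        refine ⟨y, hy, z, by simpa [t0] using hz, ?_⟩
        rw [holds_triF (s := (t.setReg 100 y).setReg 101 z) tE (by simpa [tv] using hv)
          (by simpa using hy) (by simpa using hz)]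
        simpa [tv] using h
    by_cases hc : (∃ u < n, u ≠ v ∧ ¬ adjNat G v u) ∧ ¬ ∃ y z, Tri (adjNat G) v y z
    · rw [BProg.run, if_pos (hF.2 hc)]
      obtain ⟨o1, o2⟩ := outNeighborsP_spec tE t0 (by rwa [tv])
      refine ⟨?_, tE.run (by decide), .inl (by simp [o1])⟩
      obtain ⟨⟨u, hu, huv, hvu⟩, hT⟩ := hc
      refine .inr ⟨by simp [o1], ?_⟩
      have hset : outputSet n ((outNeighborsP.run t).setReg 10 (v + 1)) =
          {w : Fin n | adjNat G v w} := by
        ext w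
        have := o2 w w.2
        rwa [tv] at this
      rw [hset]
      refine isIndependentCutset_neighborhood hv hu huv hvu fun y z h => hT ⟨y, z, h⟩
    · rw [BProg.run, if_neg (fun h => hc (hF.1 h))]
      refine ⟨by simpa [Sound, outputSet, BProg.run] using tS, tE, ?_⟩
      rcases t1 with t1 | t1
      · exact .inl (by simpa [BProg.run] using t1)
      · refine .inr fun w hw hu => ?_
        rcases Nat.lt_succ_iff_lt_or_eq.1 hw with hw | rfl
        · exact t1 w hw hu
        · by_contra hT
          exact hc ⟨hu, hT⟩
  exact ⟨key.1, key.2.2⟩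

/-- Start with the set of all vertices as the best known hitting set, in array `7` with its size in
register `3`. -/
def trivialHitP : BProg :=
  .seq (.assign 3 (.reg 0))
    (.seq (.forBelow 13 (.write 7 (.reg 13) (.reg 13))) (.assign 2 (.lit 0)))

theorem trivialHitP_spec {n : ℕ} {A : ℕ → ℕ → Prop} {s : Store}
    (hA : ∀ u v, A u v → u < n ∧ v < n) (h0 : s.reg 0 = n) :
    (trivialHitP.run s).reg 3 = n ∧ (trivialHitP.run s).reg 2 = 0 ∧
      HitSet A (trivialHitP.run s) := by
  have h3 : (trivialHitP.run s).reg 3 = n := by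
    simp only [trivialHitP, BProg.run_seq]
    rw [BProg.run_assign, Store.setReg_reg, if_neg (by decide), BProg.run_reg (by decide)]
    simp [BProg.run, Expr.eval, h0]
  have h7 : ∀ i < n, (trivialHitP.run s).arr 7 i = i := by
    simp only [trivialHitP, BProg.run_seq]
    refine BProg.run_for (i := 13) (s := (BProg.assign 3 (.reg 0)).run s)
      (p := .write 7 (.reg 13) (.reg 13)) (by simp [BProg.run, h0]) (by decide)
      (fun j t => ∀ i < j, t.arr 7 i = i) (by simp) ?_
    intro j hj t ht tj t0 i hi
    rcases Nat.lt_succ_iff_lt_or_eq.1 hi with hi | rfl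
    · simpa [BProg.run, Expr.eval, tj, hi.ne] using ht i hi
    · simp [BProg.run, Expr.eval, tj]
  refine ⟨h3, by simp [trivialHitP, BProg.run, Expr.eval], fun x y z h => .inl ?_⟩
  have hx := (hA _ _ h.1).1
  exact ⟨x, by rwa [h3], (h7 x hx).symm⟩

/-- Everything before the two searches. -/
def preludeP : BProg := .seq setupP (.seq neighborhoodsP trivialHitP)

/-- Keep the list of array `6` if it is shorter than the one in array `7`. -/
def improveP : BProg :=
  .ite (.nz (.sub (.reg 3) (.reg 5)))
    (.seq (.assign 3 (.reg 5)) (.forBelow 13 (.write 7 (.reg 13) (.arr 6 (.reg 13))))) .skip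

theorem improveP_spec {n : ℕ} {A : ℕ → ℕ → Prop} {s : Store} {L : List ℕ} (h0 : s.reg 0 = n)
    (h3 : s.reg 3 ≤ n) (hL : Rep n L s) (hLA : Hits A {v | v ∈ L}) (hs : HitSet A s) :
    HitSet A (improveP.run s) ∧ (improveP.run s).reg 3 ≤ s.reg 3 ∧
      (improveP.run s).reg 3 ≤ L.length := by
  by_cases h : L.length < s.reg 3
  · rw [improveP, BProg.run, if_pos (by simp only [Formula.Holds, Expr.eval, hL.len]; omega),
      BProg.run_seq]
    set s₁ := (BProg.assign 3 (.reg 5)).run s with hs₁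
    have e3 : (BProg.run (.forBelow 13 (.write 7 (.reg 13) (.arr 6 (.reg 13)))) s₁).reg 3 =
        L.length := by
      rw [BProg.run_reg (by decide)]
      simp [hs₁, BProg.run, Expr.eval, hL.len]
    refine ⟨?_, by rw [e3]; exact h.le, e3.le⟩
    have h7 : (BProg.run (.forBelow 13 (.write 7 (.reg 13) (.arr 6 (.reg 13)))) s₁).arr 6 =
        s.arr 6 ∧
        ∀ i < n, (BProg.run (.forBelow 13 (.write 7 (.reg 13) (.arr 6 (.reg 13)))) s₁).arr 7 i =
          s.arr 6 i := by
      refine BProg.run_for (i := 13) (s := s₁) (p := .write 7 (.reg 13) (.arr 6 (.reg 13)))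
        (by simp [hs₁, BProg.run, h0]) (by decide)
        (fun j t => t.arr 6 = s.arr 6 ∧ ∀ i < j, t.arr 7 i = s.arr 6 i) ⟨rfl, by simp⟩ ?_
      rintro j hj t ⟨t6, ht⟩ tj t0
      refine ⟨by rw [Store.setReg_arr, BProg.run_arr (by decide), t6], fun i hi => ?_⟩
      rcases Nat.lt_succ_iff_lt_or_eq.1 hi with hi | rfl
      · simpa [BProg.run, Expr.eval, tj, hi.ne] using ht i hi
      · simp [BProg.run, Expr.eval, tj, t6]
    have hmem : ∀ v ∈ L, ∃ i < L.length,
        v = (BProg.run (.forBelow 13 (.write 7 (.reg 13) (.arr 6 (.reg 13)))) s₁).arr 7 i := by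
      intro v hv
      obtain ⟨i, hi, rfl⟩ := List.mem_iff_getElem.1 hv
      refine ⟨i, hi, ?_⟩
      rw [h7.2 i (by omega)]
      have := hL.list i hi
      rw [List.getElem?_eq_getElem hi] at this
      exact Option.some.inj this
    intro x y z ht
    simp only [e3]
    exact (hLA x y z ht).imp (hmem x) (Or.imp (hmem y) (hmem z))
  · rw [improveP, BProg.run, if_neg (by simp only [Formula.Holds, Expr.eval, hL.len]; omega)]
    exact ⟨hs, le_rfl, not_lt.1 h⟩

/-- One iteration of the search for a minimum hitting set. -/
def hitBodyP : BProg :=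
  .seq decodeP (.seq hitP (.seq improveP (.assign 2 (.add (.reg 2) (.lit 1)))))

theorem hitBodyP_spec {n : ℕ} {A : ℕ → ℕ → Prop} {s : Store}
    (hA : ∀ u v, A u v → u < n ∧ v < n) (hE : Env n A s.arr) (h0 : s.reg 0 = n)
    (hm : s.reg 2 < 3 ^ n) (h3 : s.reg 3 ≤ n) (hs : HitSet A s) :
    (hitBodyP.run s).reg 2 = s.reg 2 + 1 ∧ HitSet A (hitBodyP.run s) ∧
      (hitBodyP.run s).reg 3 ≤ s.reg 3 ∧ ∃ C : ℕ → ℕ, (∀ i < n, C i = s.reg 2 / 3 ^ i % 3) ∧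
        (hitBodyP.run s).reg 3 ≤ (hitList A n C).length := by
  set s₁ := decodeP.run s with hs₁
  set s₂ := hitP.run s₁ with hs₂
  set s₃ := improveP.run s₂ with hs₃
  have hrun : hitBodyP.run s = s₃.setReg 2 (s₃.reg 2 + 1) := rfl
  have E1 : Env n A s₁.arr := hE.run (by decide)
  have r1 : s₁.reg 0 = n := (BProg.run_reg (by decide) _).trans h0
  have r2 : s₂.reg 0 = n := (BProg.run_reg (by decide) _).trans r1
  have k2 : s₂.reg 3 = s.reg 3 := by
    rw [hs₂, BProg.run_reg (by decide), hs₁, BProg.run_reg (by decide)]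
  have m3 : s₃.reg 2 = s.reg 2 := by
    rw [hs₃, BProg.run_reg (by decide), hs₂, BProg.run_reg (by decide), hs₁,
      BProg.run_reg (by decide)]
  have b2 : s₂.arr 7 = s.arr 7 := by
    rw [hs₂, BProg.run_arr (by decide), hs₁, BProg.run_arr (by decide)]
  have hL := rep_hitP E1 r1
  obtain ⟨i1, i2, i3⟩ := improveP_spec r2 (by rwa [k2]) hL (hits_hitList hA _)
    (by rw [HitSet, k2, b2]; exact hs)
  rw [hrun]
  refine ⟨by simp [m3], by simpa [HitSet] using i1, by simpa [← k2] using i2, s₁.arr 4,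
    decodeP_spec hE h0 hm, by simpa using i3⟩

/-- One iteration of the search for an independent cutset. -/
def cutBodyP : BProg :=
  .seq decodeP (.seq pairsP (.assign 2 (.add (.reg 2) (.lit 1))))

theorem cutBodyP_spec {n : ℕ} {G : SimpleGraph (Fin n)} {s : Store}
    (hE : Env n (adjNat G) s.arr) (h0 : s.reg 0 = n) (hm : s.reg 2 < 3 ^ n) (h3 : s.reg 3 ≤ n)
    (hS : Sound G s) :
    (cutBodyP.run s).reg 2 = s.reg 2 + 1 ∧ Keeps G s (cutBodyP.run s) ∧
      ((∀ v < n, ∃ y z, Tri (adjNat G) v y z) → HitSet (adjNat G) s →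
        (∃ (σ : ℕ → Fin 3) (a b : ℕ), a < n ∧ b < n ∧ Proper (adjNat G) σ ∧ σ a = 1 ∧ σ b = 2 ∧
          ∀ i < s.reg 3, s.reg 2 / 3 ^ i % 3 = (σ (s.arr 7 i)).val) →
        (cutBodyP.run s).reg 1 = 1) := by
  set s₁ := decodeP.run s with hs₁
  set s₂ := pairsP.run s₁ with hs₂
  have hrun : cutBodyP.run s = s₂.setReg 2 (s₂.reg 2 + 1) := rfl
  have E1 : Env n (adjNat G) s₁.arr := hE.run (by decide)
  have r1 : s₁.reg 0 = n := (BProg.run_reg (by decide) _).trans h0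
  have a1 : s₁.reg 1 = s.reg 1 := BProg.run_reg (by decide) _
  have k1 : s₁.reg 3 = s.reg 3 := BProg.run_reg (by decide) _
  have b1 : s₁.arr 7 = s.arr 7 := BProg.run_arr (by decide) _
  have o1 : s₁.arr 1 = s.arr 1 := BProg.run_arr (by decide) _
  have S1 : Sound G s₁ := by simpa [Sound, outputSet, a1, o1] using hS
  have m2 : s₂.reg 2 = s.reg 2 := by
    rw [hs₂, BProg.run_reg (by decide), hs₁, BProg.run_reg (by decide)]
  obtain ⟨p1, p2⟩ := pairsP_spec E1 r1 S1
  have K1 : Keeps G s s₁ := ⟨E1, S1, k1, b1, fun h => a1.trans h⟩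
  have K2 := K1.trans p1
  rw [hrun]
  refine ⟨by simp [m2], ⟨K2.env, ?_, by simpa using K2.reg3, K2.arr7, by simpa using K2.ans⟩, ?_⟩
  · simpa [Sound, outputSet] using K2.sound
  · rintro hT hH ⟨σ, a, b, ha, hb, hσ, σa, σb, hd⟩
    rw [Store.setReg_reg, if_neg (by decide)]
    refine p2 hT (by rw [HitSet, k1, b1]; exact hH) (by rwa [k1]) ⟨a, b, σ, hσ, ha, hb, σa, σb, ?_⟩
    intro i hi
    rw [k1] at hi
    rw [b1, ← hd i hi]
    exact decodeP_spec hE h0 hm i (by omega)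

/-! ### The complete program -/

/-- The test `register 2 < 3 ^ (register 3)`. -/
def guardE : Expr := .sub (.arr 3 (.reg 3)) (.reg 2)

/-- The program for the independent cutset problem. -/
def solver : Program :=
  .seq preludeP.code (.seq (.loop guardE hitBodyP.code) (.seq
    (.seq (BProg.assign 2 (.lit 0)).code (.loop guardE cutBodyP.code)) (.assign 0 (.reg 1))))

/-- A loop around a bounded program. As the program determines the memory only up to the scratch
registers, the invariant `I` is asked of some memory that agrees with the actual one. -/
theorem runs_loop_code {e : Expr} {p : BProg} {s s' : Store} {n : ℕ} (B : ℕ)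
    (I : ℕ → Store → Prop) (he : e.regsIn (fun x => decide (x < 100)) = true) (hp : p.wf = true)
    (hn : ∀ j s, I j s → s.reg 0 = n) (h0 : I 0 s) (hs : s.Agree s')
    (hstep : ∀ j s, I j s → e.eval s ≠ 0 → j < B ∧ I (j + 1) (p.run s)) :
    Runs (.loop e p.code) s' (B * (e.cost + 1 + p.time.eval n) + (e.cost + 1))
      (fun t' => ∃ t, t.Agree t' ∧ e.eval t = 0 ∧ ∃ j, I j t) := by
  refine (runs_loop B (fun j t' => ∃ t, t.Agree t' ∧ I j t) ⟨s, hs, h0⟩ ?_).mono le_rfl ?_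
  · rintro j t' ⟨t, ht, hI⟩ hg
    rw [← Expr.eval_agree ht he] at hg
    obtain ⟨hj, hI'⟩ := hstep j t hI hg
    refine ⟨hj, (BProg.runs_code hp ht).mono (by rw [hn j t hI]) fun u' hu => ⟨_, hu, hI'⟩⟩
  · rintro t' ⟨j, ⟨t, ht, hI⟩, hg⟩
    rw [← Expr.eval_agree ht he] at hg
    exact ⟨t, ht, hg, j, hI⟩

/-- What holds in the first search after `m` iterations; `mo` is a number whose digits lead to a
minimum hitting set. -/
structure HitInv {n : ℕ} (G : SimpleGraph (Fin n)) (mo m : ℕ) (s : Store) : Prop where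
  env : Env n (adjNat G) s.arr
  reg0 : s.reg 0 = n
  reg2 : s.reg 2 = m
  reg3 : s.reg 3 ≤ n
  sound : Sound G s
  first : s.reg 1 = 1 ∨ NoNeighborhood (adjNat G) n
  hit : HitSet (adjNat G) s
  best : mo < m → s.reg 3 ≤ triangleHittingNumber G

theorem hitInv_preludeP {n : ℕ} (G : SimpleGraph (Fin n)) (mo : ℕ) :
    HitInv G mo 0 (preludeP.run (inputStore G)) := by
  set s₁ := setupP.run (inputStore G) with hs₁
  set s₂ := neighborhoodsP.run s₁ with hs₂
  set s₃ := trivialHitP.run s₂ with hs₃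
  have hrun : preludeP.run (inputStore G) = s₃ := rfl
  have E1 : Env n (adjNat G) s₁.arr := env_setupP G
  have E2 : Env n (adjNat G) s₂.arr := E1.run (by decide)
  have E3 : Env n (adjNat G) s₃.arr := E2.run (by decide)
  have r1 : s₁.reg 0 = n := (BProg.run_reg (by decide) _).trans rfl
  have r2 : s₂.reg 0 = n := (BProg.run_reg (by decide) _).trans r1
  have r3 : s₃.reg 0 = n := (BProg.run_reg (by decide) _).trans r2
  have S1 : Sound G s₁ := .inl (BProg.run_reg (by decide) _)
  obtain ⟨p1, p2⟩ := neighborhoodsP_spec E1 r1 S1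
  obtain ⟨t1, t2, t3⟩ := trivialHitP_spec (adjNat_lt G) r2
  have a3 : s₃.reg 1 = s₂.reg 1 := BProg.run_reg (by decide) _
  have o3 : s₃.arr 1 = s₂.arr 1 := BProg.run_arr (by decide) _
  rw [hrun]
  refine ⟨E3, r3, t2, t1.le, ?_, ?_, t3, fun h => by omega⟩
  · have : Sound G s₂ := p1
    simpa [Sound, outputSet, a3, o3] using this
  · rw [a3]
    exact p2

/-- The program is correct and fast. For the first search, fix a minimum hitting set and a number
`mo < 3 ^ k` whose digits lead to it; the search ends with a minimum hitting set after at most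
`3 ^ k` iterations. -/
theorem exists_solver : ∃ q : Polynomial ℕ, ∀ (n : ℕ) (G : SimpleGraph (Fin n)),
    SolvesWithin solver G (3 ^ triangleHittingNumber G * q.eval n) := by
  refine ⟨preludeP.time + Polynomial.C (guardE.cost + 1) + hitBodyP.time +
    Polynomial.C (guardE.cost + 1) + 2 + Polynomial.C (guardE.cost + 1) + cutBodyP.time +
    Polynomial.C (guardE.cost + 1) + 2, fun n G => ?_⟩
  set τ := triangleHittingNumber G with hτ
  obtain ⟨X, hX, hXc, hXn⟩ := exists_hits_card_eq G
  rw [← hτ] at hXc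
  obtain ⟨d, hd⟩ := exists_digits_hitList n hX
  obtain ⟨mo, hmo, hdig⟩ := exists_nat_digits τ d
  have hguard : ∀ s : Store, Env n (adjNat G) s.arr → s.reg 3 ≤ n →
      (guardE.eval s ≠ 0 ↔ s.reg 2 < 3 ^ s.reg 3) := by
    intro s hE h3
    simp only [guardE, Expr.eval, hE.pow _ h3]
    omega
  have hpow : ∀ s : Store, s.reg 3 ≤ n → 3 ^ s.reg 3 ≤ 3 ^ n :=
    fun s h => Nat.pow_le_pow_right (by norm_num) h
  -- Up to the iteration for `mo`, the counter `m` is at most `mo < 3 ^ τ`. After it, the best hitting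
  -- set has at most `τ` elements, so the guard stops the search at `3 ^ τ`.
  have first : ∀ s', (preludeP.run (inputStore G)).Agree s' →
      Runs (.loop guardE hitBodyP.code) s'
        (3 ^ τ * (guardE.cost + 1 + hitBodyP.time.eval n) + (guardE.cost + 1))
        (fun t' => ∃ t, t.Agree t' ∧ (∃ m, HitInv G mo m t) ∧ t.reg 3 ≤ τ) := by
    intro s' hs'
    refine (runs_loop_code (3 ^ τ) (HitInv G mo) (by decide) (by decide)
      (fun j s h => h.reg0) (hitInv_preludeP G mo) hs' ?_).mono le_rfl ?_
    · intro m s h hg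
      rw [hguard s h.env h.reg3, h.reg2] at hg
      have hm : s.reg 2 < 3 ^ n := by
        rw [h.reg2]
        exact hg.trans_le (hpow s h.reg3)
      obtain ⟨b1, b2, b3, C, hC, b4⟩ := hitBodyP_spec (adjNat_lt G) h.env h.reg0 hm h.reg3 h.hit
      have a1 : (hitBodyP.run s).reg 1 = s.reg 1 := BProg.run_reg (by decide) _
      have o1 : (hitBodyP.run s).arr 1 = s.arr 1 := BProg.run_arr (by decide) _
      refine ⟨?_, h.env.run (by decide), (BProg.run_reg (by decide) _).trans h.reg0,
        by rw [b1, h.reg2], b3.trans h.reg3, ?_, by rw [a1]; exact h.first, b2, fun hlt => ?_⟩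
      · by_cases hlt : mo < m
        · exact hg.trans_le (Nat.pow_le_pow_right (by norm_num) (h.best hlt))
        · omega
      · simpa [Sound, outputSet, a1, o1] using h.sound
      · rcases Nat.lt_succ_iff_lt_or_eq.1 hlt with hlt | rfl
        · exact b3.trans (h.best hlt)
        · refine b4.trans ((hd C fun i hi => ?_).trans hXc.le)
          rw [hC i (by omega), h.reg2]
          exact hdig i (by omega)
    · rintro t' ⟨t, ht, hg, m, h⟩
      refine ⟨t, ht, ⟨m, h⟩, h.best ?_⟩
      have hmin : τ ≤ t.reg 3 := by
        have := triangleHittingNumber_le_length (G := G)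
          (L := (List.range (t.reg 3)).map (t.arr 7)) (by
            intro x y z hxyz
            have := h.hit x y z hxyz
            simpa [eq_comm] using this)
        simpa using this
      have hng := (hguard t h.env h.reg3).not.1 (by simp [hg])
      rw [h.reg2, not_lt] at hng
      exact hmo.trans_le ((Nat.pow_le_pow_right (by norm_num) hmin).trans hng)
  -- The second search goes through all labellings of the hitting set found by the first one.
  have second : ∀ s s' : Store, s.Agree s' → (∃ m, HitInv G mo m s) → s.reg 3 ≤ τ →
      Runs (.seq (BProg.assign 2 (.lit 0)).code (.loop guardE cutBodyP.code)) s'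
        (2 + (3 ^ τ * (guardE.cost + 1 + cutBodyP.time.eval n) + (guardE.cost + 1)))
        (fun t' => ∃ t, t.Agree t' ∧ t.reg 0 = n ∧ Sound G t ∧
          ((∃ S, IsIndependentCutset G S) → t.reg 1 = 1)) := by
    rintro s s' hs ⟨m₀, hI⟩ hk
    refine Runs.seq (Q := fun t' => (s.setReg 2 0).Agree t')
      ((BProg.runs_code (p := .assign 2 (.lit 0)) (by decide) hs).mono
        (by simp [BProg.time, Expr.cost]) fun _ h => h) ?_
    intro s₁' hs₁
    -- Invariant: if the digits of a number tried so far agree with a solution, one was found.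
    refine (runs_loop_code (s := s.setReg 2 0) (3 ^ τ) (fun m t => Keeps G s t ∧ t.reg 0 = n ∧
      t.reg 2 = m ∧ ∀ m' < m, (∀ v < n, ∃ y z, Tri (adjNat G) v y z) →
        (∃ (σ : ℕ → Fin 3) (a b : ℕ), a < n ∧ b < n ∧ Proper (adjNat G) σ ∧ σ a = 1 ∧ σ b = 2 ∧
          ∀ i < s.reg 3, m' / 3 ^ i % 3 = (σ (s.arr 7 i)).val) → t.reg 1 = 1)
      (by decide) (by decide) (fun j s h => h.2.1) ?_ hs₁ ?_).mono le_rfl ?_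
    · refine ⟨⟨hI.env, ?_, by simp, rfl, by simp⟩, by simp [hI.reg0], by simp, by simp⟩
      simpa [Sound, outputSet] using hI.sound
    · rintro m t ⟨tk, t0, t2, tg⟩ hg
      have t3 : t.reg 3 ≤ n := by rw [tk.reg3]; exact hI.reg3
      rw [hguard t tk.env t3, t2] at hg
      have hm : t.reg 2 < 3 ^ n := by
        rw [t2]
        exact hg.trans_le (hpow t t3)
      obtain ⟨c1, c2, c3⟩ := cutBodyP_spec tk.env t0 hm t3 tk.sound
      rw [tk.reg3] at hg
      refine ⟨hg.trans_le (Nat.pow_le_pow_right (by norm_num) hk), tk.trans c2,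
        (BProg.run_reg (by decide) _).trans t0, by rw [c1, t2], fun m' hm' hT hσ => ?_⟩
      rcases Nat.lt_succ_iff_lt_or_eq.1 hm' with hm' | rfl
      · exact c2.ans (tg m' hm' hT hσ)
      · refine c3 hT ?_ ?_
        · rw [HitSet, tk.reg3, tk.arr7]
          exact hI.hit
        · rw [tk.reg3, tk.arr7, t2]
          exact hσ
    · rintro t' ⟨t, ht, hg, m, tk, t0, t2, tg⟩
      refine ⟨t, ht, t0, tk.sound, ?_⟩
      rintro ⟨S, hS⟩
      rcases hI.first with h1 | hN
      · exact tk.ans h1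
      obtain ⟨σ, a, b, ha, hb, hσ, σa, σb⟩ := exists_proper_of_isIndependentCutset hS
      have hab : a ≠ b := by
        rintro rfl
        rw [σa] at σb
        exact absurd σb (by decide)
      have hA : ¬ adjNat G a b := by
        intro h
        refine hσ a b h ?_
        rw [σa, σb]
        decide
      have hT := exists_tri_of_no_neighborhood (adjNat_lt G) hN ha hb hab hA
      obtain ⟨m', hm', hd'⟩ := exists_nat_digits (s.reg 3) fun i => σ (s.arr 7 i)
      have t3 : t.reg 3 ≤ n := by rw [tk.reg3]; exact hI.reg3
      have hng := (hguard t tk.env t3).not.1 (by simp [hg])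
      rw [t2, not_lt, tk.reg3] at hng
      exact tg m' (by omega) hT ⟨σ, a, b, ha, hb, hσ, σa, σb, hd'⟩
  have total : Runs solver (inputStore G) (preludeP.time.eval n +
      ((3 ^ τ * (guardE.cost + 1 + hitBodyP.time.eval n) + (guardE.cost + 1)) +
      ((2 + (3 ^ τ * (guardE.cost + 1 + cutBodyP.time.eval n) + (guardE.cost + 1))) + 2)))
      (fun s => (s.reg 0 = 1 ∧ IsIndependentCutset G (outputSet n s)) ∨
        (s.reg 0 = 0 ∧ ¬ ∃ S : Set (Fin n), IsIndependentCutset G S)) := by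
    refine Runs.seq ((BProg.runs_code (by decide) (s := inputStore G) (s' := inputStore G)
      ⟨rfl, fun _ _ => rfl⟩).mono (by simp [inputStore]) fun _ h => h) fun s₁ h₁ => ?_
    refine Runs.seq (first s₁ h₁) ?_
    rintro s₂ ⟨s, hs, hI, hk⟩
    refine Runs.seq (second s s₂ hs hI hk) ?_
    rintro s₃ ⟨t, ht, t0, tS, tC⟩
    have h1 : s₃.reg 1 = t.reg 1 := (ht.2 1 (by norm_num)).symm
    have ho : ∀ x, outputSet n (s₃.setReg 0 x) = outputSet n t := fun x => by
      simp [outputSet, ht.1]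
    refine runs_assign ?_
    rw [ho]
    simp only [Store.setReg_reg, if_true, Expr.eval, h1]
    rcases tS with tS | tS
    · refine .inr ⟨tS, fun hS => ?_⟩
      rw [tC hS] at tS
      exact one_ne_zero tS
    · exact .inl tS
  obtain ⟨t, s, he, ht, hs⟩ := total
  refine ⟨t, s, he, ht.trans ?_, hs⟩
  have h1 : 1 ≤ 3 ^ τ := Nat.one_le_pow _ _ (by norm_num)
  simp only [Polynomial.eval_add, Polynomial.eval_C, Polynomial.eval_ofNat]
  nlinarith

end IndCut

/-- The independent cutset problem on connected graphs can be solved in time `O*(3 ^ k)`, where `k`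
is the odd cycle transversal number, and also where `k` is the minimum size of a triangle-hitting
set. The parameter `k` is not part of the input, and the program and the polynomial do not depend on
the graph. -/
theorem mainTheorem7 :
    (∃ (p : IndCut.Program) (q : Polynomial ℕ),
      ∀ (n : ℕ) (G : SimpleGraph (Fin n)), G.Connected →
        IndCut.SolvesWithin p G (3 ^ IndCut.oddCycleTransversalNumber G * q.eval n)) ∧
    (∃ (p : IndCut.Program) (q : Polynomial ℕ),
      ∀ (n : ℕ) (G : SimpleGraph (Fin n)), G.Connected →
        IndCut.SolvesWithin p G (3 ^ IndCut.triangleHittingNumber G * q.eval n)) := by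
  obtain ⟨q, hq⟩ := IndCut.exists_solver
  refine ⟨⟨IndCut.solver, q, fun n G _ => ?_⟩, ⟨IndCut.solver, q, fun n G _ => hq n G⟩⟩
  obtain ⟨t, s, he, ht, hs⟩ := hq n G
  refine ⟨t, s, he, ht.trans (Nat.mul_le_mul_right _ (Nat.pow_le_pow_right (by norm_num) ?_)), hs⟩
  exact IndCut.triangleHittingNumber_le_oddCycleTransversalNumber G
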